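/- Let $a>0$ and let $V:[-a,a]\to\mathbb{R}$ be piecewise continuous and (essentially) bounded; $V$ need not be even. Let $AC^2[-a,a]$ be the set of differentiable $f:[-a,a]\to\mathbb{C}$ such that $f'$ is absolutely continuous and $f''\in L^2[-a,a]$. Let $A=-\frac{d^2}{dx^2}+V$ be the operator on $L^2[-a,a]$ with domain $\{f\in AC^2[-a,a] : f(\pm a)=f'(\pm a)=0\}$, let $A^\dagger$ be its adjoint and $\mathscr K_\pm=\mathrm{Ker}(A^\dagger\mp i)$. Let $g_1,g_2\in AC^2[-a,a]$ be orthonormal in $L^2[-a,a]$ with $-g_j''+Vg_j=ig_j$ almost everywhere. Then $\mathscr K_+=\mathrm{span}\{g_1,g_2\}$ and $\mathscr K_-=\mathrm{span}\{\overline{g_1},\overline{g_2}\}$, and the unitary matrices $U=(u_{jk})\in U(2)$ correspond one-to-one to the unitary maps $\mathscr K_+\to\mathscr K_-$, also denoted by $U$, through $Ug_j=\sum_k u_{jk}\overline{g_k}$. For $U\in U(2)$ let $A_U$ be the restriction of $A^\dagger$ to the domain $\{f_0+g+Ug : f_0\in\mathrm{Dom}\,\bar A,\ g\in\mathscr K_+\}$,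 so that $A_U(f_0+g+Ug)=A^\dagger f_0+ig-iUg$. The map $U\mapsto A_U$ is a bijection of $U(2)$ onto the set of self-adjoint extensions of $A$. For a complex $2\times2$ matrix $U$ put $G_j=g_j+\sum_k u_{jk}\overline{g_k}$ and $$\vec z_j^{\,(+)}=\begin{pmatrix}G_j'(a)-iG_j(a)\\ G_j'(-a)+iG_j(-a)\end{pmatrix},\qquad \vec z_j^{\,(-)}=\begin{pmatrix}G_j'(a)+iG_j(a)\\ G_j'(-a)-iG_j(-a)\end{pmatrix},\qquad j=1,2.$$ If $U$ is unitary, then $\vec z_1^{\,(+)},\vec z_2^{\,(+)}$ are linearly independent, and so are $\vec z_1^{\,(-)},\vec z_2^{\,(-)}$. There is a bijection $U\mapsto\mathcal U$ of $U(2)$ onto $U(2)$, characterized implicitly as follows: for every complex $2\times 2$ matrix $U$ and every unitary matrix $M$, one has $\vec z_j^{\,(-)}=M\,\vec z_j^{\,(+)}$ for $j=1,2$ if and only if $U$ is unitary and $M=\mathcal U$. Finally, for every $U\in U(2)$, $A_U$ is the operator $f\mapsto -f''+Vf$ whose domain is the set of all $f\in AC^2[-a,a]$ with $$\begin{pmatrix}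 f'(a)+if(a)\\ f'(-a)-if(-a)\end{pmatrix}=\mathcal U\begin{pmatrix} f'(a)-if(a)\\ f'(-a)+if(-a)\end{pmatrix}.$$ Hence the self-adjoint extensions $A_U$ of $A$ are in one-to-one correspondence with these boundary conditions, parametrized by the unitary matrices $\mathcal U$. -/

import Mathlib

open MeasureTheory Set Filter Topology

namespace SchrodingerBC

/-- Lebesgue measure on `[-a, a]`. -/
noncomputable abbrev μI (a : ℝ) : Measure ℝ := volume.restrict (Icc (-a) a)

/-- The complex Hilbert space `L²[-a, a]` (inner product conjugate-linear in the first slot). -/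
abbrev L2I (a : ℝ) : Type := Lp ℂ 2 (μI a)

/-- The derivative of `f` on `[-a, a]`, one-sided at the end points. -/
noncomputable def D1 (a : ℝ) (f : ℝ → ℂ) : ℝ → ℂ := derivWithin f (Icc (-a) a)

/-- The second derivative of `f` on `[-a, a]`. -/
noncomputable def D2 (a : ℝ) (f : ℝ → ℂ) : ℝ → ℂ := derivWithin (D1 a f) (Icc (-a) a)

/-- `f ∈ AC²[-a, a]`: `f` is differentiable on `[-a, a]`, `f'` is absolutely continuous there, and
`f'' ∈ L²[-a, a]`. Only the values of `f` on `[-a, a]` matter. -/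
structure IsAC2 (a : ℝ) (f : ℝ → ℂ) : Prop where
  diff : DifferentiableOn ℝ f (Icc (-a) a)
  ac : AbsolutelyContinuousOnInterval (D1 a f) (-a) a
  memLp : MemLp (D2 a f) 2 (μI a)

/-- The boundary data `(f(a), f'(a), f(-a), f'(-a))`. -/
noncomputable def traces (a : ℝ) (f : ℝ → ℂ) : Fin 4 → ℂ :=
  ![f a, D1 a f a, f (-a), D1 a f (-a)]

/-- The differential expression `-f'' + V f`. -/
noncomputable def expr (a : ℝ) (V : ℝ → ℝ) (f : ℝ → ℂ) : ℝ → ℂ :=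
  fun x => -D2 a f x + (V x : ℂ) * f x

theorem IsAC2.memLp_self {a : ℝ} {f : ℝ → ℂ} (hf : IsAC2 a f) : MemLp f 2 (μI a) := by
  obtain ⟨C, hC⟩ := isCompact_Icc.exists_bound_of_continuousOn hf.diff.continuousOn
  refine MemLp.of_bound (hf.diff.continuousOn.aestronglyMeasurable measurableSet_Icc) C ?_
  exact (ae_restrict_iff' measurableSet_Icc).2 (Eventually.of_forall hC)

/-- The class of `f ∈ AC²[-a, a]` in `L²[-a, a]`. -/
noncomputable def IsAC2.toL2 {a : ℝ} {f : ℝ → ℂ} (hf : IsAC2 a f) : L2I a :=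
  hf.memLp_self.toLp f

theorem D1_add {a : ℝ} {f h : ℝ → ℂ} (hf : IsAC2 a f) (hh : IsAC2 a h) {x : ℝ}
    (hx : x ∈ Icc (-a) a) : D1 a (f + h) x = D1 a f x + D1 a h x :=
  derivWithin_add (hf.diff x hx) (hh.diff x hx)

theorem D1_smul {a : ℝ} (c : ℂ) (f : ℝ → ℂ) : D1 a (c • f) = c • D1 a f := by
  funext x
  exact derivWithin_const_smul_field c f

theorem D2_smul {a : ℝ} (c : ℂ) (f : ℝ → ℂ) : D2 a (c • f) = c • D2 a f := by
  funext x
  rw [D2, D1_smul]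
  exact derivWithin_const_smul_field c (D1 a f)

theorem ac_congr {a b : ℝ} {f h : ℝ → ℂ} (hf : AbsolutelyContinuousOnInterval f a b)
    (hfh : EqOn f h (uIcc a b)) : AbsolutelyContinuousOnInterval h a b := by
  rw [absolutelyContinuousOnInterval_iff] at hf ⊢
  intro ε hε
  obtain ⟨δ, hδ, H⟩ := hf ε hε
  refine ⟨δ, hδ, fun E hE hl => ?_⟩
  have := H E hE hl
  refine lt_of_le_of_lt (le_of_eq (Finset.sum_congr rfl fun i hi => ?_)) this
  rw [hfh (hE.1 i hi).1, hfh (hE.1 i hi).2]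

theorem IsAC2.ae_diff {a : ℝ} (ha : 0 < a) {f : ℝ → ℂ} (hf : IsAC2 a f) :
    ∀ᵐ x ∂(μI a), DifferentiableWithinAt ℝ (D1 a f) (Icc (-a) a) x := by
  have h := hf.ac.boundedVariationOn
  rw [uIcc_of_le (by linarith)] at h
  rw [ae_restrict_iff' measurableSet_Icc]
  exact h.locallyBoundedVariationOn.ae_differentiableWithinAt_of_mem

theorem D2_add {a : ℝ} (ha : 0 < a) {f h : ℝ → ℂ} (hf : IsAC2 a f) (hh : IsAC2 a h) :
    D2 a (f + h) =ᵐ[μI a] D2 a f + D2 a h := by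
  filter_upwards [hf.ae_diff ha, hh.ae_diff ha, ae_restrict_mem measurableSet_Icc]
    with x h1 h2 hx
  have : D2 a (f + h) x = derivWithin (D1 a f + D1 a h) (Icc (-a) a) x :=
    derivWithin_congr (fun y hy => D1_add hf hh hy) (D1_add hf hh hx)
  rw [this, derivWithin_add h1 h2]
  rfl

theorem IsAC2.add {a : ℝ} (ha : 0 < a) {f h : ℝ → ℂ} (hf : IsAC2 a f) (hh : IsAC2 a h) :
    IsAC2 a (f + h) where
  diff := hf.diff.add hh.diff
  ac := ac_congr (hf.ac.add hh.ac) fun x hx => by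
    rw [uIcc_of_le (by linarith)] at hx
    exact (D1_add hf hh hx).symm
  memLp := (hf.memLp.add hh.memLp).ae_eq (D2_add ha hf hh).symm

theorem IsAC2.smul {a : ℝ} {f : ℝ → ℂ} (hf : IsAC2 a f) (c : ℂ) : IsAC2 a (c • f) where
  diff := hf.diff.const_smul c
  ac := by rw [D1_smul]; exact hf.ac.const_smul c
  memLp := by rw [D2_smul]; exact hf.memLp.const_smul c

theorem isAC2_zero (a : ℝ) : IsAC2 a 0 := by
  have h1 : D1 a 0 = 0 := by simpa using D1_smul (a := a) 0 0
  have h2 : D2 a 0 = 0 := by simpa using D2_smul (a := a) 0 0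
  refine ⟨differentiableOn_const 0, ?_, ?_⟩
  · rw [h1, absolutelyContinuousOnInterval_iff]
    intro ε hε
    exact ⟨1, one_pos, fun E _ _ => by simpa using hε⟩
  · rw [h2]; exact MemLp.zero

theorem traces_add {a : ℝ} (ha : 0 < a) {f h : ℝ → ℂ} (hf : IsAC2 a f) (hh : IsAC2 a h) :
    traces a (f + h) = traces a f + traces a h := by
  have h1 := D1_add hf hh (x := a) ⟨by linarith, le_rfl⟩
  have h2 := D1_add hf hh (x := -a) ⟨le_rfl, by linarith⟩
  simp [traces, h1, h2]

theorem traces_smul {a : ℝ} (c : ℂ) (f : ℝ → ℂ) : traces a (c • f) = c • traces a f := by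
  simp [traces, D1_smul]

/-- The graph of the operator `f ↦ -f'' + V f` on `L²[-a, a]` with domain the set of all
`f ∈ AC²[-a, a]` whose boundary data lie in the subspace `B`. -/
noncomputable def schrodingerGraph (a : ℝ) (ha : 0 < a) (V : ℝ → ℝ) (B : Submodule ℂ (Fin 4 → ℂ)) :
    Submodule ℂ (L2I a × L2I a) where
  carrier := {p | ∃ f : ℝ → ℂ, IsAC2 a f ∧ traces a f ∈ B ∧
    p.1 =ᵐ[μI a] f ∧ p.2 =ᵐ[μI a] expr a V f}
  zero_mem' := by
    refine ⟨0, isAC2_zero a, ?_, Lp.coeFn_zero _ _ _, ?_⟩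
    · have : traces a 0 = 0 := by simpa using traces_smul (a := a) 0 0
      rw [this]; exact B.zero_mem
    · have h2 : D2 a 0 = 0 := by simpa using D2_smul (a := a) 0 0
      refine (Lp.coeFn_zero _ _ _).trans (Eventually.of_forall fun x => ?_)
      simp [expr, h2]
  add_mem' := by
    rintro p q ⟨f, hf, hfB, hf1, hf2⟩ ⟨h, hh, hhB, hh1, hh2⟩
    refine ⟨f + h, hf.add ha hh, ?_, ?_, ?_⟩
    · rw [traces_add ha hf hh]; exact B.add_mem hfB hhB
    · exact (Lp.coeFn_add _ _).trans (hf1.add hh1)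
    · refine (Lp.coeFn_add _ _).trans ?_
      filter_upwards [hf2, hh2, D2_add ha hf hh] with x h1 h2 h3
      rw [Pi.add_apply, h1, h2]
      simp only [expr, h3, Pi.add_apply]
      ring
  smul_mem' := by
    rintro c p ⟨f, hf, hfB, hf1, hf2⟩
    refine ⟨c • f, hf.smul c, ?_, ?_, ?_⟩
    · rw [traces_smul]; exact B.smul_mem c hfB
    · exact (Lp.coeFn_smul _ _).trans (hf1.const_smul c)
    · refine (Lp.coeFn_smul _ _).trans ?_
      filter_upwards [hf2] with x h1
      rw [Pi.smul_apply, h1]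
      simp only [expr, D2_smul, Pi.smul_apply, smul_eq_mul]
      ring

/-- The operator `f ↦ -f'' + V f` on `L²[-a, a]` with domain the set of all `f ∈ AC²[-a, a]` (with
`-f'' + V f ∈ L²[-a, a]`, which is automatic for the potentials considered here) whose boundary data
lie in the subspace `B`. -/
noncomputable def schrodinger (a : ℝ) (ha : 0 < a) (V : ℝ → ℝ) (B : Submodule ℂ (Fin 4 → ℂ)) :
    L2I a →ₗ.[ℂ] L2I a :=
  (schrodingerGraph a ha V B).toLinearPMap

theorem schrodingerGraph_single {a : ℝ} {ha : 0 < a} {V : ℝ → ℝ} {B : Submodule ℂ (Fin 4 → ℂ)}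
    (p : L2I a × L2I a) (hp : p ∈ schrodingerGraph a ha V B) (h0 : p.1 = 0) : p.2 = 0 := by
  obtain ⟨f, hf, -, h1, h2⟩ := hp
  have hae : f =ᵐ[μI a] fun _ => (0 : ℂ) := by
    refine h1.symm.trans ?_
    rw [h0]
    exact Lp.coeFn_zero _ _ _
  have hz : EqOn f (fun _ => 0) (Icc (-a) a) :=
    Measure.eqOn_Icc_of_ae_eq volume (by linarith) hae hf.diff.continuousOn continuousOn_const
  have hd1 : EqOn (D1 a f) (fun _ => 0) (Icc (-a) a) := fun x hx => by
    have := derivWithin_congr hz (hz hx)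
    simpa [D1] using this
  have hd2 : EqOn (D2 a f) (fun _ => 0) (Icc (-a) a) := fun x hx => by
    have := derivWithin_congr hd1 (hd1 hx)
    simpa [D2] using this
  refine Lp.ext (h2.trans (EventuallyEq.trans ?_ (Lp.coeFn_zero _ _ _).symm))
  filter_upwards [ae_restrict_mem measurableSet_Icc] with x hx
  simp [expr, hz hx, hd2 hx]

/-- The graph of the operator is the prescribed one. -/
theorem schrodinger_graph (a : ℝ) (ha : 0 < a) (V : ℝ → ℝ) (B : Submodule ℂ (Fin 4 → ℂ)) :
    (schrodinger a ha V B).graph = schrodingerGraph a ha V B :=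
  Submodule.toLinearPMap_graph_eq _ schrodingerGraph_single

/-- The symmetric operator `A = -d²/dx² + V` with
`Dom A = {f ∈ AC²[-a, a] | f(a) = f(-a) = f'(a) = f'(-a) = 0}`. -/
noncomputable def minimalOp (a : ℝ) (ha : 0 < a) (V : ℝ → ℝ) : L2I a →ₗ.[ℂ] L2I a :=
  schrodinger a ha V ⊥

/-- The boundary condition
`(f'(a) + i f(a), f'(-a) - i f(-a))ᵀ = M (f'(a) - i f(a), f'(-a) + i f(-a))ᵀ`,
as a subspace of boundary data `t = (f(a), f'(a), f(-a), f'(-a))`. -/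
noncomputable def bcSubspace (M : Matrix (Fin 2) (Fin 2) ℂ) : Submodule ℂ (Fin 4 → ℂ) where
  carrier := {t | ![t 1 + Complex.I * t 0, t 3 - Complex.I * t 2] =
    M.mulVec ![t 1 - Complex.I * t 0, t 3 + Complex.I * t 2]}
  zero_mem' := by
    ext i; fin_cases i <;> simp [Matrix.mulVec, dotProduct, Fin.sum_univ_two]
  add_mem' := by
    intro s t hs ht
    simp only [Set.mem_ofPred_eq, funext_iff, Fin.forall_fin_two, Matrix.mulVec, dotProduct,
      Fin.sum_univ_two, Matrix.cons_val_zero, Matrix.cons_val_one, Pi.add_apply] at hs ht ⊢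
    exact ⟨by linear_combination hs.1 + ht.1, by linear_combination hs.2 + ht.2⟩
  smul_mem' := by
    intro c t ht
    simp only [Set.mem_ofPred_eq, funext_iff, Fin.forall_fin_two, Matrix.mulVec, dotProduct,
      Fin.sum_univ_two, Matrix.cons_val_zero, Matrix.cons_val_one, Pi.smul_apply,
      smul_eq_mul] at ht ⊢
    exact ⟨by linear_combination c * ht.1, by linear_combination c * ht.2⟩

/-- The operator `-d²/dx² + V` on the functions in `AC²[-a, a]` that satisfy the boundary condition
given by the matrix `M`. -/
noncomputable def bcOp (a : ℝ) (ha : 0 < a) (V : ℝ → ℝ) (M : Matrix (Fin 2) (Fin 2) ℂ) :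
    L2I a →ₗ.[ℂ] L2I a :=
  schrodinger a ha V (bcSubspace M)

/-- `Ker (T† - c)`, for an operator `T` on a Hilbert space. -/
noncomputable def deficiencySpace {H : Type*} [NormedAddCommGroup H] [InnerProductSpace ℂ H]
    [CompleteSpace H] (T : H →ₗ.[ℂ] H) (c : ℂ) : Submodule ℂ H :=
  T.adjoint.graph.comap (LinearMap.prod LinearMap.id (c • LinearMap.id))

/-- The von Neumann extension of `T` given by a unitary map `W` of `Ker (T† - i)` onto
`Ker (T† + i)`: its domain is `{f₀ + φ + W φ | f₀ ∈ Dom (closure of T), φ ∈ Ker (T† - i)}`, and it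
acts there as `T†`, that is, by `f₀ + φ + W φ ↦ T† f₀ + i φ - i W φ`. -/
noncomputable def vonNeumannExt {H : Type*} [NormedAddCommGroup H] [InnerProductSpace ℂ H]
    [CompleteSpace H] (T : H →ₗ.[ℂ] H)
    (W : deficiencySpace T Complex.I ≃ₗᵢ[ℂ] deficiencySpace T (-Complex.I)) : H →ₗ.[ℂ] H :=
  T.adjoint.domRestrict (T.closure.domain ⊔
    LinearMap.range ((deficiencySpace T Complex.I).subtype +
      (deficiencySpace T (-Complex.I)).subtype ∘ₗ W.toLinearEquiv.toLinearMap))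

/-- `G_j = g_j + ∑ₖ u_{jk} \overline{g_k}`. -/
noncomputable def G (g : Fin 2 → ℝ → ℂ) (U : Matrix (Fin 2) (Fin 2) ℂ) (j : Fin 2) : ℝ → ℂ :=
  fun x => g j x + ∑ k, U j k * star (g k x)

/-- `z_j⁽⁺⁾ = (G_j'(a) - i G_j(a), G_j'(-a) + i G_j(-a))ᵀ`. -/
noncomputable def zPlus (a : ℝ) (g : Fin 2 → ℝ → ℂ) (U : Matrix (Fin 2) (Fin 2) ℂ) (j : Fin 2) :
    Fin 2 → ℂ :=
  ![D1 a (G g U j) a - Complex.I * G g U j a, D1 a (G g U j) (-a) + Complex.I * G g U j (-a)]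

/-- `z_j⁽⁻⁾ = (G_j'(a) + i G_j(a), G_j'(-a) - i G_j(-a))ᵀ`. -/
noncomputable def zMinus (a : ℝ) (g : Fin 2 → ℝ → ℂ) (U : Matrix (Fin 2) (Fin 2) ℂ) (j : Fin 2) :
    Fin 2 → ℂ :=
  ![D1 a (G g U j) a + Complex.I * G g U j a, D1 a (G g U j) (-a) - Complex.I * G g U j (-a)]

end SchrodingerBC

/-!
All self-adjoint extensions of `A` are read off from the boundary data
`t = (f(a), f'(a), f(-a), f'(-a)) ∈ ℂ⁴` of functions `f ∈ AC²[-a, a]`.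

Green's identity (`traceRel_green`) expresses `⟪A† f, h⟫ - ⟪f, A† h⟫` through a skew-hermitian form
`bdForm` of the boundary data. Together with the regularity statement
`adjoint_schrodingerGraph_bot_le`, by which the domain of `A†` is contained in `AC²`, it shows that
the operator with boundary data in a subspace `B` has as its adjoint the operator with boundary data
in the orthogonal complement of `B` (`adjoint_schrodinger`). Hence the self-adjoint extensions of
`A` are exactly the operators whose subspace `B` is Lagrangian, that is, equal to its own orthogonal
complement (`exists_lagrangian_of_isSelfAdjoint`).

The regularity statement needs no approximation by smooth functions: if `(h, k)` is in the adjoint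
of the graph of `A` and `u'' = V h - k`, then `h - u` is orthogonal to `f''` for all `f` in the
domain of `A`, hence affine (`eq_affine_of_orthogonal`). The density of the domain is the case `h = 0`.

A splitting of `ℂ⁴` into two copies of `ℂ²` on which `bdForm` is a multiple of the difference of the
standard inner products identifies the Lagrangian subspaces with the graphs of unitary matrices
(`IsSplitting.lagrangianEquiv`). Two splittings matter. One is given by `f'(±a) ∓ i f(±a)` and
`f'(±a) ± i f(±a)`, and the graphs in it are the boundary conditions of the theorem. The other is
given by the coordinates along the boundary data of `g_j` and of `conj g_j`: by Green's identity
these four vectors are orthogonal for `bdForm`, so that they form a basis (`IsDeficiencyFrame`). This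
gives the deficiency spaces without any uniqueness theorem for the differential equation
(`deficiencySpaces_eq_span`), and the graphs in this splitting are the spans of the boundary data of
the `G_j`, that is, the von Neumann extensions (`vonNeumannExt_eq_schrodinger`). Comparing the two
parametrizations of Lagrangian subspaces yields the bijection `U ↦ 𝒰` (`IsDeficiencyFrame.bcEquiv`).
-/

namespace SchrodingerBC

/-! ### Absolutely continuous complex functions -/

/-- On a closed interval, one-sided and two-sided derivatives differ at most at the end points. -/
theorem hasDerivAt_of_ae_within {F d : ℝ → ℂ} {a b : ℝ}
    (h : ∀ᵐ x ∂(volume.restrict (Icc a b)), HasDerivWithinAt F (d x) (Icc a b) x) :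
    ∀ᵐ x, x ∈ Icc a b → HasDerivAt F (d x) x := by
  have h₁ : ∀ᵐ x : ℝ, x ≠ a := by simp [ae_iff, measure_singleton]
  have h₂ : ∀ᵐ x : ℝ, x ≠ b := by simp [ae_iff, measure_singleton]
  rw [ae_restrict_iff' measurableSet_Icc] at h
  filter_upwards [h, h₁, h₂] with x hx hxa hxb hxm
  exact (hx hxm).hasDerivAt
    (Icc_mem_nhds (lt_of_le_of_ne hxm.1 hxa.symm) (lt_of_le_of_ne hxm.2 hxb))

/-- Absolute continuity passes to a function whose increments are dominated by those of an
absolutely continuous one. -/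
theorem ac_of_dist_le {X Y : Type*} [PseudoMetricSpace X] [PseudoMetricSpace Y]
    {f : ℝ → X} {h : ℝ → Y} {a b : ℝ} (hf : AbsolutelyContinuousOnInterval f a b)
    (hfh : ∀ x y, dist (h x) (h y) ≤ dist (f x) (f y)) :
    AbsolutelyContinuousOnInterval h a b := by
  rw [absolutelyContinuousOnInterval_iff] at hf ⊢
  intro ε hε
  obtain ⟨δ, hδ, H⟩ := hf ε hε
  exact ⟨δ, hδ, fun E hE hl => (Finset.sum_le_sum fun i _ => hfh _ _).trans_lt (H E hE hl)⟩

/-- An indefinite integral is absolutely continuous; the complex case follows from the real one by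
splitting into real and imaginary parts. -/
theorem ac_intervalIntegral {φ : ℝ → ℂ} {a b : ℝ} (hφ : IntervalIntegrable φ volume a b) :
    AbsolutelyContinuousOnInterval (fun x => ∫ v in a..x, φ v) a b := by
  have hre : IntervalIntegrable (fun x => (φ x).re) volume a b := ⟨hφ.1.re, hφ.2.re⟩
  have him : IntervalIntegrable (fun x => (φ x).im) volume a b := ⟨hφ.1.im, hφ.2.im⟩
  have h1 := hre.absolutelyContinuousOnInterval_intervalIntegral (c := a) (by simp)
  have h2 := him.absolutelyContinuousOnInterval_intervalIntegral (c := a) (by simp)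
  have h3 := ac_of_dist_le (h := fun x => ((∫ v in a..x, (φ v).re : ℝ) : ℂ)) h1
    fun x y => by rw [Complex.dist_eq, ← Complex.ofReal_sub, Complex.norm_real, Real.dist_eq,
      Real.norm_eq_abs]
  have h4 := ac_of_dist_le (h := fun x => ((∫ v in a..x, (φ v).im : ℝ) : ℂ)) h2
    fun x y => by rw [Complex.dist_eq, ← Complex.ofReal_sub, Complex.norm_real, Real.dist_eq,
      Real.norm_eq_abs]
  refine ac_congr (h3.add (h4.const_smul Complex.I)) fun x hx => ?_
  have hx' : IntervalIntegrable φ volume a x :=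
    hφ.mono_set (uIcc_subset_uIcc_left hx)
  have e1 := Complex.reCLM.intervalIntegral_comp_comm hx'
  have e2 := Complex.imCLM.intervalIntegral_comp_comm hx'
  simp only [Complex.reCLM_apply, Complex.imCLM_apply] at e1 e2
  simp only [Pi.add_apply, e1, e2, smul_eq_mul]
  rw [mul_comm]
  exact Complex.re_add_im _

/-- The fundamental theorem of calculus for a complex-valued absolutely continuous function: the
difference between the function and the integral of its derivative has vanishing derivative almost
everywhere, hence is constant. -/
theorem integral_eq_sub_of_ac {F d : ℝ → ℂ} {a b : ℝ} (hab : a ≤ b)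
    (hF : AbsolutelyContinuousOnInterval F a b) (hd : IntervalIntegrable d volume a b)
    (h : ∀ᵐ x ∂(volume.restrict (Icc a b)), HasDerivWithinAt F (d x) (Icc a b) x) :
    ∫ x in a..b, d x = F b - F a := by
  have hz : ∀ᵐ x, x ∈ uIcc a b →
      HasDerivAt (F - fun x => ∫ v in a..x, d v) 0 x := by
    filter_upwards [hasDerivAt_of_ae_within h, hd.ae_hasDerivAt_integral] with x h1 h2 hx
    have := (h1 (uIcc_of_le hab ▸ hx)).sub (h2 hx a (by simp))
    rwa [sub_self] at this
  obtain ⟨C, hC⟩ := (hF.sub (ac_intervalIntegral hd)).const_of_ae_hasDerivAt_zero hz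
  have ha := hC a (by simp)
  have hb := hC b (by simp)
  simp only [Pi.sub_apply, intervalIntegral.integral_same, sub_zero] at ha hb
  linear_combination ha - hb

/-! ### Calculus in `AC²[-a, a]` -/

theorem IsAC2.hasDerivWithinAt {a : ℝ} {f : ℝ → ℂ} (hf : IsAC2 a f) {x : ℝ}
    (hx : x ∈ Icc (-a) a) : HasDerivWithinAt f (D1 a f x) (Icc (-a) a) x :=
  (hf.diff x hx).hasDerivWithinAt

theorem IsAC2.ae_hasDerivWithinAt {a : ℝ} (ha : 0 < a) {f : ℝ → ℂ} (hf : IsAC2 a f) :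
    ∀ᵐ x ∂(μI a), HasDerivWithinAt (D1 a f) (D2 a f x) (Icc (-a) a) x := by
  filter_upwards [hf.ae_diff ha] with x hx using hx.hasDerivWithinAt

theorem IsAC2.continuousOn_D1 {a : ℝ} (ha : 0 < a) {f : ℝ → ℂ} (hf : IsAC2 a f) :
    ContinuousOn (D1 a f) (Icc (-a) a) := by
  have := hf.ac.continuousOn
  rwa [uIcc_of_le (by linarith)] at this

/-- `f ∈ AC²` is absolutely continuous, being Lipschitz because `f'` is bounded. -/
theorem IsAC2.ac_self {a : ℝ} (ha : 0 < a) {f : ℝ → ℂ} (hf : IsAC2 a f) :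
    AbsolutelyContinuousOnInterval f (-a) a := by
  obtain ⟨C, hC⟩ := isCompact_Icc.exists_bound_of_continuousOn (hf.continuousOn_D1 ha)
  have h : LipschitzOnWith C.toNNReal f (Icc (-a) a) :=
    (convex_Icc _ _).lipschitzOnWith_of_nnnorm_hasDerivWithin_le
      (fun x hx => hf.hasDerivWithinAt hx)
      fun x hx => NNReal.le_toNNReal_of_coe_le (hC x hx)
  rw [← uIcc_of_le (show -a ≤ a by linarith)] at h
  exact h.absolutelyContinuousOnInterval

theorem D1_star (a : ℝ) (f : ℝ → ℂ) : D1 a (star f) = star (D1 a f) := by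
  funext x
  exact derivWithin.star

theorem D2_star (a : ℝ) (f : ℝ → ℂ) : D2 a (star f) = star (D2 a f) := by
  funext x
  rw [D2, D1_star]
  exact derivWithin.star

theorem IsAC2.star {a : ℝ} {f : ℝ → ℂ} (hf : IsAC2 a f) : IsAC2 a (star f) where
  diff := fun x hx => (hf.diff x hx).star
  ac := by
    rw [D1_star]
    exact ac_of_dist_le hf.ac fun x y => (dist_star_star _ _).le
  memLp := by rw [D2_star]; exact hf.memLp.star

theorem traces_star (a : ℝ) (f : ℝ → ℂ) : traces a (star f) = star (traces a f) := by
  ext i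
  fin_cases i <;> simp [traces, D1_star]

theorem expr_star (a : ℝ) (V : ℝ → ℝ) (f : ℝ → ℂ) :
    expr a V (star f) = star (expr a V f) := by
  funext x
  simp [expr, D2_star]

theorem expr_add {a : ℝ} (ha : 0 < a) (V : ℝ → ℝ) {f h : ℝ → ℂ} (hf : IsAC2 a f)
    (hh : IsAC2 a h) : expr a V (f + h) =ᵐ[μI a] expr a V f + expr a V h := by
  filter_upwards [D2_add ha hf hh] with x hx
  simp only [expr, Pi.add_apply, hx]
  ring

theorem expr_smul (a : ℝ) (V : ℝ → ℝ) (c : ℂ) (f : ℝ → ℂ) :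
    expr a V (c • f) = c • expr a V f := by
  funext x
  simp only [expr, D2_smul, Pi.smul_apply, smul_eq_mul]
  ring

theorem memLp_intervalIntegrable {a : ℝ} (ha : 0 < a) {φ : ℝ → ℂ} (hφ : MemLp φ 2 (μI a)) :
    IntervalIntegrable φ volume (-a) a := by
  rw [intervalIntegrable_iff_integrableOn_Icc_of_le (by linarith)]
  exact hφ.integrable (by norm_num)

/-- **Green's identity** for `AC²` functions: integrate the derivative of the absolutely continuous
function `conj f * h' - conj f' * h`. -/
theorem green {a : ℝ} (ha : 0 < a) {f h : ℝ → ℂ} (hf : IsAC2 a f) (hh : IsAC2 a h) :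
    ∫ x, (star (f x) * D2 a h x - star (D2 a f x) * h x) ∂(μI a) =
      (star (f a) * D1 a h a - star (D1 a f a) * h a) -
        (star (f (-a)) * D1 a h (-a) - star (D1 a f (-a)) * h (-a)) := by
  have hfac := hf.star.ac_self ha
  have hfac' := hf.star.ac
  have hW : AbsolutelyContinuousOnInterval
      ((star f) • D1 a h - D1 a (star f) • h) (-a) a :=
    (hfac.smul hh.ac).sub (hfac'.smul (hh.ac_self ha))
  have hint : Integrable (fun x => star (f x) * D2 a h x - star (D2 a f x) * h x) (μI a) :=
    (MemLp.integrable_mul hf.memLp_self.star hh.memLp).sub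
      (MemLp.integrable_mul hf.memLp.star hh.memLp_self)
  have key := integral_eq_sub_of_ac (by linarith) hW
    (d := fun x => star (f x) * D2 a h x - star (D2 a f x) * h x)
    ((intervalIntegrable_iff_integrableOn_Icc_of_le (by linarith)).2 hint) (by
      filter_upwards [hh.ae_hasDerivWithinAt ha, hf.star.ae_hasDerivWithinAt ha,
        ae_restrict_mem measurableSet_Icc] with x h1 h2 hx
      have h3 := hf.star.hasDerivWithinAt hx
      have h4 := hh.hasDerivWithinAt hx
      convert! (h3.smul h1).sub (h2.smul h4) using 1
      simp only [D2_star, Pi.star_apply, smul_eq_mul]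
      ring)
  rw [intervalIntegral.integral_of_le (by linarith), ← integral_Icc_eq_integral_Ioc] at key
  rw [key]
  simp [D1_star]

/-- The double antiderivative of `φ` with initial values `c₀`, `c₁` at `-a`. -/
noncomputable def dblInt (a : ℝ) (c₀ c₁ : ℂ) (φ : ℝ → ℂ) (x : ℝ) : ℂ :=
  c₀ + ∫ s in (-a)..x, (c₁ + ∫ v in (-a)..s, φ v)

theorem continuousOn_inner {a : ℝ} (ha : 0 < a) {φ : ℝ → ℂ} (hφ : MemLp φ 2 (μI a)) (c₁ : ℂ) :
    ContinuousOn (fun s => c₁ + ∫ v in (-a)..s, φ v) (Icc (-a) a) := by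
  have := (ac_intervalIntegral (memLp_intervalIntegrable ha hφ)).continuousOn
  rw [uIcc_of_le (by linarith)] at this
  exact continuousOn_const.add this

theorem hasDerivWithinAt_dblInt {a : ℝ} (ha : 0 < a) {φ : ℝ → ℂ} (hφ : MemLp φ 2 (μI a))
    (c₀ c₁ : ℂ) {x : ℝ} (hx : x ∈ Icc (-a) a) :
    HasDerivWithinAt (dblInt a c₀ c₁ φ) (c₁ + ∫ v in (-a)..x, φ v) (Icc (-a) a) x := by
  have hc := continuousOn_inner ha hφ c₁
  refine HasDerivWithinAt.const_add c₀ ?_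
  have : Fact (x ∈ Icc (-a) a) := ⟨hx⟩
  refine intervalIntegral.integral_hasDerivWithinAt_right ?_
    (hc.stronglyMeasurableAtFilter_nhdsWithin measurableSet_Icc x) (hc x hx)
  refine ContinuousOn.intervalIntegrable (hc.mono ?_)
  rw [uIcc_of_le hx.1]
  exact Icc_subset_Icc_right hx.2

theorem D1_dblInt {a : ℝ} (ha : 0 < a) {φ : ℝ → ℂ} (hφ : MemLp φ 2 (μI a))
    (c₀ c₁ : ℂ) {x : ℝ} (hx : x ∈ Icc (-a) a) :
    D1 a (dblInt a c₀ c₁ φ) x = c₁ + ∫ v in (-a)..x, φ v :=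
  (hasDerivWithinAt_dblInt ha hφ c₀ c₁ hx).derivWithin
    (uniqueDiffOn_Icc (by linarith) x hx)

theorem D2_dblInt {a : ℝ} (ha : 0 < a) {φ : ℝ → ℂ} (hφ : MemLp φ 2 (μI a)) (c₀ c₁ : ℂ) :
    D2 a (dblInt a c₀ c₁ φ) =ᵐ[μI a] φ := by
  have h := (memLp_intervalIntegrable ha hφ).ae_hasDerivAt_integral
  rw [uIcc_of_le (by linarith), ← ae_restrict_iff' measurableSet_Icc] at h
  filter_upwards [h, ae_restrict_mem measurableSet_Icc] with x h1 hx
  have h2 := ((h1 (-a) ⟨le_rfl, by linarith⟩).const_add c₁).hasDerivWithinAt (s := Icc (-a) a)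
  have h3 := h2.congr (fun y hy => D1_dblInt ha hφ c₀ c₁ hy) (D1_dblInt ha hφ c₀ c₁ hx)
  exact h3.derivWithin (uniqueDiffOn_Icc (by linarith) x hx)

theorem isAC2_dblInt {a : ℝ} (ha : 0 < a) {φ : ℝ → ℂ} (hφ : MemLp φ 2 (μI a)) (c₀ c₁ : ℂ) :
    IsAC2 a (dblInt a c₀ c₁ φ) where
  diff := fun _ hx => (hasDerivWithinAt_dblInt ha hφ c₀ c₁ hx).differentiableWithinAt
  ac := by
    have h0 : AbsolutelyContinuousOnInterval (fun _ : ℝ => c₁) (-a) a :=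
      (LipschitzWith.const c₁).lipschitzOnWith.absolutelyContinuousOnInterval
    refine ac_congr (h0.add (ac_intervalIntegral (memLp_intervalIntegrable ha hφ)))
      fun x hx => ?_
    rw [uIcc_of_le (by linarith)] at hx
    exact (D1_dblInt ha hφ c₀ c₁ hx).symm
  memLp := hφ.ae_eq (D2_dblInt ha hφ c₀ c₁).symm

theorem dblInt_left (a : ℝ) (c₀ c₁ : ℂ) (φ : ℝ → ℂ) : dblInt a c₀ c₁ φ (-a) = c₀ := by
  simp [dblInt]

theorem D1_dblInt_left {a : ℝ} (ha : 0 < a) {φ : ℝ → ℂ} (hφ : MemLp φ 2 (μI a)) (c₀ c₁ : ℂ) :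
    D1 a (dblInt a c₀ c₁ φ) (-a) = c₁ := by
  simp [D1_dblInt ha hφ c₀ c₁ (x := -a) ⟨le_rfl, by linarith⟩]

/-! ### Boundary data as a linear relation -/

/-- The linear relation between the graph of the maximal operator and the boundary data: it
consists of the triples `((f, -f'' + V f), traces f)` with `f ∈ AC²[-a, a]`. -/
noncomputable def traceRel (a : ℝ) (ha : 0 < a) (V : ℝ → ℝ) :
    Submodule ℂ ((L2I a × L2I a) × (Fin 4 → ℂ)) where
  carrier := {q | ∃ f : ℝ → ℂ, IsAC2 a f ∧ traces a f = q.2 ∧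
    q.1.1 =ᵐ[μI a] f ∧ q.1.2 =ᵐ[μI a] expr a V f}
  zero_mem' := by
    refine ⟨0, isAC2_zero a, by simpa using traces_smul (a := a) 0 0, Lp.coeFn_zero _ _ _, ?_⟩
    have h : expr a V 0 = 0 := by simpa using expr_smul a V 0 0
    rw [h]
    exact Lp.coeFn_zero _ _ _
  add_mem' := by
    rintro p q ⟨f, hf, hft, hf1, hf2⟩ ⟨h, hh, hht, hh1, hh2⟩
    refine ⟨f + h, hf.add ha hh, ?_, (Lp.coeFn_add _ _).trans (hf1.add hh1),
      (Lp.coeFn_add _ _).trans ((hf2.add hh2).trans (expr_add ha V hf hh).symm)⟩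
    rw [traces_add ha hf hh, hft, hht]
    rfl
  smul_mem' := by
    rintro c p ⟨f, hf, hft, hf1, hf2⟩
    refine ⟨c • f, hf.smul c, ?_, (Lp.coeFn_smul _ _).trans (hf1.const_smul c), ?_⟩
    · rw [traces_smul, hft]
      rfl
    · rw [expr_smul]
      exact (Lp.coeFn_smul _ _).trans (hf2.const_smul c)

/-- The operator with boundary data in `B` is the preimage of `B` under the relation `traceRel`. -/
theorem mem_schrodingerGraph_iff {a : ℝ} {ha : 0 < a} {V : ℝ → ℝ}
    {B : Submodule ℂ (Fin 4 → ℂ)} {p : L2I a × L2I a} :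
    p ∈ schrodingerGraph a ha V B ↔ ∃ t ∈ B, (p, t) ∈ traceRel a ha V := by
  constructor
  · rintro ⟨f, hf, hB, h1, h2⟩
    exact ⟨_, hB, f, hf, rfl, h1, h2⟩
  · rintro ⟨t, ht, f, hf, hft, h1, h2⟩
    exact ⟨f, hf, by rwa [hft], h1, h2⟩

theorem schrodingerGraph_mono {a : ℝ} {ha : 0 < a} {V : ℝ → ℝ}
    {B C : Submodule ℂ (Fin 4 → ℂ)} (h : B ≤ C) :
    schrodingerGraph a ha V B ≤ schrodingerGraph a ha V C := by
  intro p hp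
  obtain ⟨t, ht, hpt⟩ := mem_schrodingerGraph_iff.1 hp
  exact mem_schrodingerGraph_iff.2 ⟨t, h ht, hpt⟩

theorem mem_schrodingerGraph_bot {a : ℝ} {ha : 0 < a} {V : ℝ → ℝ} {p : L2I a × L2I a} :
    p ∈ schrodingerGraph a ha V ⊥ ↔ (p, (0 : Fin 4 → ℂ)) ∈ traceRel a ha V := by
  simp [mem_schrodingerGraph_iff]

/-- The continuous representative of an `L²` class, hence the boundary data, are unique. -/
theorem traceRel_unique {a : ℝ} {ha : 0 < a} {V : ℝ → ℝ} {p q : L2I a × L2I a}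
    {s t : Fin 4 → ℂ} (hs : (p, s) ∈ traceRel a ha V) (ht : (q, t) ∈ traceRel a ha V)
    (hpq : p.1 = q.1) : s = t := by
  obtain ⟨f, hf, rfl, hf1, -⟩ := hs
  obtain ⟨h, hh, rfl, hh1, -⟩ := ht
  have hz : EqOn f h (Icc (-a) a) :=
    Measure.eqOn_Icc_of_ae_eq volume (by linarith) (hf1.symm.trans (by rwa [hpq]))
      hf.diff.continuousOn hh.diff.continuousOn
  have hd (x : ℝ) (hx : x ∈ Icc (-a) a) : D1 a f x = D1 a h x := derivWithin_congr hz (hz hx)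
  have hl : -a ∈ Icc (-a) a := ⟨le_rfl, by linarith⟩
  have hr : a ∈ Icc (-a) a := ⟨by linarith, le_rfl⟩
  simp [traces, hz hl, hz hr, hd _ hl, hd _ hr]

/-- The boundary form of Green's identity, on boundary data
`t = (f(a), f'(a), f(-a), f'(-a))`. -/
noncomputable def bdForm : (Fin 4 → ℂ) →ₗ⋆[ℂ] (Fin 4 → ℂ) →ₗ[ℂ] ℂ :=
  LinearMap.mk₂'ₛₗ (starRingEnd ℂ) (RingHom.id ℂ)
    (fun s t => (star (s 0) * t 1 - star (s 1) * t 0) - (star (s 2) * t 3 - star (s 3) * t 2))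
    (fun _ _ _ => by simp only [Pi.add_apply, star_add]; ring)
    (fun _ _ _ => by simp; ring)
    (fun _ _ _ => by simp only [Pi.add_apply]; ring)
    (fun _ _ _ => by simp; ring)

theorem bdForm_apply (s t : Fin 4 → ℂ) :
    bdForm s t =
      (star (s 0) * t 1 - star (s 1) * t 0) - (star (s 2) * t 3 - star (s 3) * t 2) := rfl

theorem bdForm_swap (s t : Fin 4 → ℂ) : bdForm t s = -star (bdForm s t) := by
  simp only [bdForm_apply, star_sub, star_mul', star_star]
  ring

theorem bdForm_star (s t : Fin 4 → ℂ) : bdForm (star s) (star t) = star (bdForm s t) := by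
  simp [bdForm_apply]

/-- **Green's identity** for pairs in the graph of the maximal operator; the contribution of the
potential cancels since `V` is real. -/
theorem traceRel_green {a : ℝ} {ha : 0 < a} {V : ℝ → ℝ} {p q : L2I a × L2I a}
    {s t : Fin 4 → ℂ} (hs : (p, s) ∈ traceRel a ha V) (ht : (q, t) ∈ traceRel a ha V) :
    inner ℂ p.2 q.1 - inner ℂ p.1 q.2 = bdForm s t := by
  obtain ⟨f, hf, rfl, hf1, hf2⟩ := hs
  obtain ⟨h, hh, rfl, hh1, hh2⟩ := ht
  have hg := green ha hf hh
  rw [L2.inner_def, L2.inner_def,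
    ← integral_sub (L2.integrable_inner _ _) (L2.integrable_inner _ _)]
  have : bdForm (traces a f) (traces a h) =
      (star (f a) * D1 a h a - star (D1 a f a) * h a) -
        (star (f (-a)) * D1 a h (-a) - star (D1 a f (-a)) * h (-a)) := rfl
  rw [this, ← hg]
  refine integral_congr_ae ?_
  filter_upwards [hf1, hf2, hh1, hh2] with x h1 h2 h3 h4
  have hV : star (V x : ℂ) = V x := Complex.conj_ofReal _
  simp only [h1, h2, h3, h4, expr, RCLike.inner_apply, map_add, map_mul, map_neg,
    starRingEnd_apply, hV]
  ring

/-! ### The adjoint -/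

theorem aestronglyMeasurable_of_piecewise {a : ℝ} {V : ℝ → ℝ}
    (hVpc : ∃ S : Set ℝ, S.Finite ∧
      ∀ x ∈ Icc (-a) a \ S, ContinuousWithinAt V (Icc (-a) a) x) :
    AEStronglyMeasurable V (μI a) := by
  obtain ⟨S, hS, h⟩ := hVpc
  have hc : ContinuousOn V (Icc (-a) a \ S) := fun x hx => (h x hx).mono sdiff_subset
  have hm := hc.aestronglyMeasurable (μ := volume) (measurableSet_Icc.diff hS.measurableSet)
  rwa [Measure.restrict_congr_set (sdiff_null_ae_eq_self (hS.measure_zero volume))] at hm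

theorem memLp_potential_mul {a : ℝ} {V : ℝ → ℝ} (hVm : AEStronglyMeasurable V (μI a))
    (hVbd : ∃ C : ℝ, ∀ᵐ x ∂(μI a), |V x| ≤ C) {f : ℝ → ℂ} (hf : MemLp f 2 (μI a)) :
    MemLp (fun x => (V x : ℂ) * f x) 2 (μI a) := by
  obtain ⟨C, hC⟩ := hVbd
  refine hf.of_le_mul (c := C)
    ((Complex.continuous_ofReal.comp_aestronglyMeasurable hVm).mul hf.aestronglyMeasurable) ?_
  filter_upwards [hC] with x hx
  rw [norm_mul, Complex.norm_real, Real.norm_eq_abs]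
  gcongr

theorem memLp_expr {a : ℝ} {V : ℝ → ℝ}
    (hVm : AEStronglyMeasurable V (μI a)) (hVbd : ∃ C : ℝ, ∀ᵐ x ∂(μI a), |V x| ≤ C)
    {f : ℝ → ℂ} (hf : IsAC2 a f) : MemLp (expr a V f) 2 (μI a) :=
  hf.memLp.neg.add (memLp_potential_mul hVm hVbd hf.memLp_self)

theorem mem_traceRel {a : ℝ} {ha : 0 < a} {V : ℝ → ℝ} {f : ℝ → ℂ} (hf : IsAC2 a f)
    (h : MemLp (expr a V f) 2 (μI a)) :
    ((hf.toL2, h.toLp _), traces a f) ∈ traceRel a ha V :=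
  ⟨f, hf, rfl, hf.memLp_self.coeFn_toLp, h.coeFn_toLp⟩

/-- Green's identity in `L²` for second derivatives, that is, for the potential `0`. -/
theorem green_D2 {a : ℝ} (ha : 0 < a) {f h : ℝ → ℂ} (hf : IsAC2 a f) (hh : IsAC2 a h) :
    inner ℂ hf.toL2 (hh.memLp.toLp (D2 a h)) - inner ℂ (hf.memLp.toLp (D2 a f)) hh.toL2 =
      bdForm (traces a f) (traces a h) := by
  have h1 : ((hf.toL2, -hf.memLp.toLp (D2 a f)), traces a f) ∈ traceRel a ha 0 :=
    ⟨f, hf, rfl, hf.memLp_self.coeFn_toLp, (Lp.coeFn_neg _).trans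
      (hf.memLp.coeFn_toLp.neg.trans (Eventually.of_forall fun x => by simp [expr]))⟩
  have h2 : ((hh.toL2, -hh.memLp.toLp (D2 a h)), traces a h) ∈ traceRel a ha 0 :=
    ⟨h, hh, rfl, hh.memLp_self.coeFn_toLp, (Lp.coeFn_neg _).trans
      (hh.memLp.coeFn_toLp.neg.trans (Eventually.of_forall fun x => by simp [expr]))⟩
  rw [← traceRel_green h1 h2, inner_neg_left, inner_neg_right]
  ring

theorem dblInt_zero (a : ℝ) (c₀ c₁ : ℂ) (x : ℝ) : dblInt a c₀ c₁ 0 x = c₀ + (x + a) * c₁ := by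
  simp [dblInt]

theorem traces_dblInt_zero {a : ℝ} (ha : 0 < a) (c₀ c₁ : ℂ) :
    traces a (dblInt a c₀ c₁ 0) = ![c₀ + (a + a) * c₁, c₁, c₀, c₁] := by
  have hr : a ∈ Icc (-a) a := ⟨by linarith, le_rfl⟩
  simp [traces, D1_dblInt ha MemLp.zero _ _ hr, D1_dblInt_left ha MemLp.zero, dblInt_zero]

/-- An `L²` function orthogonal to `f''` for all `f ∈ AC²` with vanishing boundary data is affine:
the component of it orthogonal to the affine functions is itself of the form `f''`. -/
theorem eq_affine_of_orthogonal {a : ℝ} (ha : 0 < a) (w : L2I a)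
    (hw : ∀ (f : ℝ → ℂ) (hf : IsAC2 a f), traces a f = 0 →
      inner ℂ (hf.memLp.toLp (D2 a f)) w = 0) :
    ∃ c₀ c₁ : ℂ, w =ᵐ[μI a] dblInt a c₀ c₁ 0 := by
  have haff (c₀ c₁ : ℂ) : IsAC2 a (dblInt a c₀ c₁ 0) := isAC2_dblInt ha MemLp.zero c₀ c₁
  -- split `w` into its component `k` in the space `K` of affine functions and `v ⟂ K`
  let K : Submodule ℂ (L2I a) := Submodule.span ℂ {(haff 1 0).toL2, (haff 0 1).toL2}
  have : FiniteDimensional ℂ K := FiniteDimensional.span_of_finite ℂ (by simp)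
  obtain ⟨k, hk, v, hv, hkv⟩ := K.exists_add_mem_mem_orthogonal w
  have hf := isAC2_dblInt ha (Lp.memLp v) 0 0
  have hfv : hf.memLp.toLp _ = v :=
    Lp.ext (hf.memLp.coeFn_toLp.trans (D2_dblInt ha (Lp.memLp v) 0 0))
  have hD (c₀ c₁ : ℂ) : (haff c₀ c₁).memLp.toLp _ = 0 :=
    Lp.ext ((haff c₀ c₁).memLp.coeFn_toLp.trans ((D2_dblInt ha MemLp.zero c₀ c₁).trans
      (Lp.coeFn_zero _ _ _).symm))
  -- `v ⟂ K` says, by Green's identity against affine functions, that the double antiderivative of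
  -- `v` with zero initial values at `-a` has zero boundary data at `a` as well
  have hvK (c₀ c₁ : ℂ) (h : (haff c₀ c₁).toL2 ∈ K) :
      bdForm (traces a (dblInt a 0 0 v)) ![c₀ + (a + a) * c₁, c₁, c₀, c₁] = 0 := by
    have h1 := green_D2 ha hf (haff c₀ c₁)
    rw [hfv, hD, (K.mem_orthogonal' v).1 hv _ h, traces_dblInt_zero ha] at h1
    simpa using h1.symm
  have h0 := hvK 1 0 (Submodule.subset_span (by simp))
  have h1 := hvK 0 1 (Submodule.subset_span (by simp))
  have ht2 : traces a (dblInt a 0 0 v) 2 = 0 := dblInt_left _ _ _ _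
  have ht3 : traces a (dblInt a 0 0 v) 3 = 0 := D1_dblInt_left ha (Lp.memLp v) _ _
  have ht1 : traces a (dblInt a 0 0 v) 1 = 0 := by
    simpa [bdForm_apply, ht2, ht3] using h0
  have ht0 : traces a (dblInt a 0 0 v) 0 = 0 := by
    simpa [bdForm_apply, ht1, ht2, ht3] using h1
  have ht : traces a (dblInt a 0 0 v) = 0 := by
    ext i
    fin_cases i
    exacts [ht0, ht1, ht2, ht3]
  have hvv := hw _ hf ht
  rw [hfv, hkv, inner_add_right, (K.mem_orthogonal' v).1 hv _ hk, zero_add,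
    inner_self_eq_zero] at hvv
  obtain ⟨c₀, c₁, hc⟩ := Submodule.mem_span_pair.1 hk
  refine ⟨c₀, c₁, ?_⟩
  rw [hkv, hvv, add_zero, ← hc]
  filter_upwards [Lp.coeFn_add (c₀ • (haff 1 0).toL2) (c₁ • (haff 0 1).toL2),
    Lp.coeFn_smul c₀ (haff 1 0).toL2, Lp.coeFn_smul c₁ (haff 0 1).toL2,
    (haff 1 0).memLp_self.coeFn_toLp, (haff 0 1).memLp_self.coeFn_toLp] with x h1 h2 h3 h4 h5
  rw [h1, Pi.add_apply, h2, h3, Pi.smul_apply, Pi.smul_apply, IsAC2.toL2, IsAC2.toL2, h4, h5]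
  simp only [dblInt_zero, smul_eq_mul]
  ring

/-- Every pair in the adjoint of the graph of the minimal operator is of the form
`(u, -u'' + V u)` with `u ∈ AC²`: if `(h, k)` is such a pair and `u'' = V h - k`, then `h - u` is
orthogonal to all `f''` with `f` in the domain of the minimal operator, hence affine. -/
theorem adjoint_schrodingerGraph_bot_le {a : ℝ} (ha : 0 < a) {V : ℝ → ℝ}
    (hVm : AEStronglyMeasurable V (μI a)) (hVbd : ∃ C : ℝ, ∀ᵐ x ∂(μI a), |V x| ≤ C) :
    (schrodingerGraph a ha V ⊥).adjoint ≤ schrodingerGraph a ha V ⊤ := by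
  rintro ⟨h, k⟩ hhk
  rw [Submodule.mem_adjoint_iff] at hhk
  have hVh := memLp_potential_mul hVm hVbd (Lp.memLp h)
  have hφ : MemLp (fun x => (V x : ℂ) * h x - k x) 2 (μI a) := hVh.sub (Lp.memLp k)
  have hu := isAC2_dblInt ha hφ 0 0
  have hD := D2_dblInt ha hφ 0 0
  set u := dblInt a 0 0 fun x => (V x : ℂ) * h x - k x with hu_def
  obtain ⟨c₀, c₁, hw⟩ := eq_affine_of_orthogonal ha (h - hu.toL2) (by
    intro f hf ht
    have hy := memLp_expr hVm hVbd hf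
    have hA := hhk hf.toL2 (hy.toLp _)
      (mem_schrodingerGraph_bot.2 (by simpa only [ht] using mem_traceRel hf hy))
    have hG := green_D2 ha hf hu
    rw [ht, map_zero, LinearMap.zero_apply] at hG
    have hI : inner ℂ (hy.toLp _) h - inner ℂ hf.toL2 k =
        inner ℂ hf.toL2 (hu.memLp.toLp _) - inner ℂ (hf.memLp.toLp _) h := by
      simp only [L2.inner_def]
      rw [← integral_sub (L2.integrable_inner _ _) (L2.integrable_inner _ _),
        ← integral_sub (L2.integrable_inner _ _) (L2.integrable_inner _ _)]
      refine integral_congr_ae ?_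
      filter_upwards [hy.coeFn_toLp, hf.memLp_self.coeFn_toLp, hu.memLp.coeFn_toLp,
        hf.memLp.coeFn_toLp, hD] with x h1 h2 h3 h4 h5
      have hV : star (V x : ℂ) = V x := Complex.conj_ofReal _
      simp only [IsAC2.toL2, h1, h2, h3, h4, h5, expr, RCLike.inner_apply, map_add, map_mul,
        map_neg, starRingEnd_apply, hV]
      ring
    rw [inner_sub_right]
    linear_combination hG - hA + hI)
  have haff : IsAC2 a (dblInt a c₀ c₁ 0) := isAC2_dblInt ha MemLp.zero c₀ c₁
  refine ⟨u + dblInt a c₀ c₁ 0, hu.add ha haff, trivial, ?_, ?_⟩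
  · filter_upwards [hw, Lp.coeFn_sub h hu.toL2, hu.memLp_self.coeFn_toLp] with x h1 h2 h3
    rw [h2, Pi.sub_apply, IsAC2.toL2, h3] at h1
    simp [← h1]
  · filter_upwards [hw, Lp.coeFn_sub h hu.toL2, hu.memLp_self.coeFn_toLp,
      D2_add ha hu haff, hD, D2_dblInt ha MemLp.zero c₀ c₁] with x h1 h2 h3 h4 h5 h6
    rw [h2, Pi.sub_apply, IsAC2.toL2, h3] at h1
    simp only [expr, h4, Pi.add_apply, h5, h6, ← h1, Pi.zero_apply]
    ring

/-! ### Lagrangian subspaces of the space of boundary data -/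

/-- A subspace of boundary data is Lagrangian if it is its own orthogonal complement with respect
to the boundary form. -/
def IsLagrangian (B : Submodule ℂ (Fin 4 → ℂ)) : Prop :=
  B.orthogonalBilin bdForm = B

/-- A splitting `t ↦ (p t, m t)` of the boundary data into two halves in which the boundary form
is, up to the factor `κ`, the difference of the two standard inner products. -/
structure IsSplitting (p m : (Fin 4 → ℂ) →ₗ[ℂ] (Fin 2 → ℂ)) (κ : ℂ) : Prop where
  ne_zero : κ ≠ 0
  form : ∀ s t, star (p s) ⬝ᵥ p t - star (m s) ⬝ᵥ m t = κ * bdForm s t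
  inj : ∀ t, p t = 0 → m t = 0 → t = 0
  surj : ∀ x y, ∃ t, p t = x ∧ m t = y

/-- The graph of the matrix `M` in a splitting: the subspace of boundary data `t` with
`m t = M (p t)`. -/
noncomputable def coordGraph (p m : (Fin 4 → ℂ) →ₗ[ℂ] (Fin 2 → ℂ))
    (M : Matrix (Fin 2) (Fin 2) ℂ) : Submodule ℂ (Fin 4 → ℂ) :=
  LinearMap.ker (m - M.mulVecLin ∘ₗ p)

open scoped ComplexOrder in
theorem eq_zero_of_star_dotProduct_self {x : Fin 2 → ℂ} (h : star x ⬝ᵥ x = 0) : x = 0 :=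
  dotProduct_star_self_eq_zero.1 h

section Splitting

variable {p m : (Fin 4 → ℂ) →ₗ[ℂ] (Fin 2 → ℂ)} {κ : ℂ}

theorem mem_coordGraph {M : Matrix (Fin 2) (Fin 2) ℂ} {t : Fin 4 → ℂ} :
    t ∈ coordGraph p m M ↔ m t = M.mulVec (p t) := by
  rw [coordGraph, LinearMap.mem_ker, LinearMap.sub_apply, sub_eq_zero]
  rfl

theorem star_mulVec_dotProduct_mulVec {M : Matrix (Fin 2) (Fin 2) ℂ}
    (hM : M ∈ Matrix.unitaryGroup (Fin 2) ℂ) (x y : Fin 2 → ℂ) :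
    star (M.mulVec x) ⬝ᵥ M.mulVec y = star x ⬝ᵥ y := by
  rw [Matrix.star_mulVec, ← Matrix.dotProduct_mulVec, Matrix.mulVec_mulVec,
    ← Matrix.star_eq_conjTranspose, Matrix.mem_unitaryGroup_iff'.1 hM, Matrix.one_mulVec]

theorem IsSplitting.bdForm_eq_zero_iff (h : IsSplitting p m κ) (s t : Fin 4 → ℂ) :
    bdForm s t = 0 ↔ star (p s) ⬝ᵥ p t = star (m s) ⬝ᵥ m t := by
  rw [← sub_eq_zero (a := star (p s) ⬝ᵥ p t), h.form, mul_eq_zero, or_iff_right h.ne_zero]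

theorem IsSplitting.ext (h : IsSplitting p m κ) {s t : Fin 4 → ℂ} (hp : p s = p t)
    (hm : m s = m t) : s = t :=
  sub_eq_zero.1 (h.inj _ (by rw [map_sub, hp, sub_self]) (by rw [map_sub, hm, sub_self]))

/-- The graph of a unitary matrix is Lagrangian: it is isotropic because `M` preserves the inner
product, and orthogonality of `t` to all of the graph reads `p t = M* (m t)`. -/
theorem IsSplitting.isLagrangian_coordGraph (h : IsSplitting p m κ)
    {M : Matrix (Fin 2) (Fin 2) ℂ} (hM : M ∈ Matrix.unitaryGroup (Fin 2) ℂ) :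
    IsLagrangian (coordGraph p m M) := by
  ext t
  rw [Submodule.mem_orthogonalBilin_iff]
  constructor
  · intro ht
    have key : p t = (star M).mulVec (m t) := by
      refine dotProduct_eq _ _ fun x => ?_
      obtain ⟨s, hs, hs'⟩ := h.surj (star x) (M.mulVec (star x))
      have := (h.bdForm_eq_zero_iff s t).1 (ht s (mem_coordGraph.2 (by rw [hs, hs'])))
      rw [hs, hs', Matrix.star_mulVec, ← Matrix.dotProduct_mulVec, star_star] at this
      rw [dotProduct_comm, this, dotProduct_comm, Matrix.star_eq_conjTranspose]
    rw [mem_coordGraph, key, Matrix.mulVec_mulVec, Matrix.mem_unitaryGroup_iff.1 hM,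
      Matrix.one_mulVec]
  · intro ht s hs
    rw [mem_coordGraph] at hs ht
    rw [h.bdForm_eq_zero_iff, hs, ht, star_mulVec_dotProduct_mulVec hM]

theorem IsSplitting.eq_of_coordGraph_le (h : IsSplitting p m κ)
    {M N : Matrix (Fin 2) (Fin 2) ℂ} (hMN : coordGraph p m M ≤ coordGraph p m N) : M = N := by
  refine Matrix.mulVec_injective (funext fun x => ?_)
  obtain ⟨t, ht, ht'⟩ := h.surj x (M.mulVec x)
  have := mem_coordGraph.1 (hMN (mem_coordGraph.2 (by rw [ht, ht'])))
  rw [← ht', this, ht]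

/-- In a splitting, every Lagrangian subspace is the graph of a unitary matrix: it projects
injectively to the first half because the form is definite there, and surjectively because a
vector `(x, 0)` orthogonal to the subspace lies in it, whence `x = 0`. -/
theorem IsSplitting.exists_coordGraph_eq (h : IsSplitting p m κ)
    {B : Submodule ℂ (Fin 4 → ℂ)} (hB : IsLagrangian B) :
    ∃ M ∈ Matrix.unitaryGroup (Fin 2) ℂ, coordGraph p m M = B := by
  have hiso : ∀ s ∈ B, ∀ t ∈ B, star (p s) ⬝ᵥ p t = star (m s) ⬝ᵥ m t := by
    intro s hs t ht
    rw [← hB] at ht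
    exact (h.bdForm_eq_zero_iff s t).1 (ht s hs)
  -- a functional vanishing on `p B` is the pairing with some vector `star x`, and the vector `t`
  -- with `p t = x`, `m t = 0` is then orthogonal to `B`
  have htop : B.map p = ⊤ := by
    by_contra hne
    obtain ⟨f, hf0, hf⟩ := Submodule.exists_le_ker_of_lt_top _ (lt_top_iff_ne_top.2 hne)
    have hfv (y : Fin 2 → ℂ) : f y = y ⬝ᵥ fun i => f (Pi.single i 1) := by
      conv_lhs => rw [pi_eq_sum_univ' y]
      simp [dotProduct]
    obtain ⟨t, ht, ht'⟩ := h.surj (star fun i => f (Pi.single i 1)) 0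
    have htB : t ∈ B := by
      rw [← hB, Submodule.mem_orthogonalBilin_iff]
      intro s hs
      have h0 : f (p s) = 0 := hf ⟨s, hs, rfl⟩
      rw [bdForm_swap, neg_eq_zero, star_eq_zero, h.bdForm_eq_zero_iff, ht, ht', star_star,
        dotProduct_comm, ← hfv, h0]
      simp
    have h0 := hiso t htB t htB
    rw [ht', ht] at h0
    have hv := eq_zero_of_star_dotProduct_self (h0.trans (by simp))
    exact hf0 (LinearMap.ext fun y => by
      rw [hfv, star_eq_zero.1 hv, dotProduct_zero, LinearMap.zero_apply])
  have hex (j : Fin 2) : ∃ t ∈ B, p t = Pi.single j 1 := by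
    have : Pi.single j 1 ∈ B.map p := htop ▸ trivial
    exact this
  choose t htB htp using hex
  let M : Matrix (Fin 2) (Fin 2) ℂ := Matrix.of fun i j => m (t j) i
  have hsum (x : Fin 2 → ℂ) : p (∑ j, x j • t j) = x ∧ m (∑ j, x j • t j) = M.mulVec x := by
    constructor
    · simp only [map_sum, map_smul, htp]
      exact (pi_eq_sum_univ' x).symm
    · ext i
      simp [M, Matrix.mulVec, dotProduct, mul_comm]
  have hmem (x : Fin 2 → ℂ) : ∑ j, x j • t j ∈ B :=
    B.sum_mem fun j _ => B.smul_mem _ (htB j)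
  refine ⟨M, ?_, le_antisymm (fun s hs => ?_) fun s hs => ?_⟩
  · rw [Matrix.mem_unitaryGroup_iff']
    ext i j
    have := hiso _ (htB i) _ (htB j)
    rw [htp, htp] at this
    simp only [Matrix.mul_apply, Matrix.star_apply, M, Matrix.of_apply]
    simp only [dotProduct, Pi.star_apply] at this
    rw [← this]
    simp [Pi.single_apply, Matrix.one_apply, eq_comm]
  · rw [h.ext (s := s) (hsum (p s)).1.symm (by rw [(hsum _).2, mem_coordGraph.1 hs])]
    exact hmem _
  · have hd := B.sub_mem hs (hmem (p s))
    have hp0 : p (s - ∑ j, p s j • t j) = 0 := by rw [map_sub, (hsum _).1, sub_self]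
    have hm0 := hiso _ hd _ hd
    rw [hp0, dotProduct_zero, eq_comm] at hm0
    replace hm0 := eq_zero_of_star_dotProduct_self hm0
    rw [mem_coordGraph, ← (hsum (p s)).2, ← sub_eq_zero, ← map_sub, hm0]

/-- The bijection between unitary matrices and Lagrangian subspaces given by a splitting. -/
noncomputable def IsSplitting.lagrangianEquiv (h : IsSplitting p m κ) :
    Matrix.unitaryGroup (Fin 2) ℂ ≃ {B // IsLagrangian B} :=
  Equiv.ofBijective (fun M => ⟨coordGraph p m M, h.isLagrangian_coordGraph M.2⟩)
    ⟨fun _ _ hMN => Subtype.ext (h.eq_of_coordGraph_le (congrArg Subtype.val hMN).le),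
      fun B => by
        obtain ⟨M, hM, hMB⟩ := h.exists_coordGraph_eq B.2
        exact ⟨⟨M, hM⟩, Subtype.ext hMB⟩⟩

theorem IsSplitting.coe_lagrangianEquiv (h : IsSplitting p m κ)
    (M : Matrix.unitaryGroup (Fin 2) ℂ) :
    (h.lagrangianEquiv M : Submodule ℂ (Fin 4 → ℂ)) = coordGraph p m M := rfl

end Splitting

/-- The half `(f'(a) - i f(a), f'(-a) + i f(-a))` of the boundary data. -/
noncomputable def plusData : (Fin 4 → ℂ) →ₗ[ℂ] (Fin 2 → ℂ) where
  toFun t := ![t 1 - Complex.I * t 0, t 3 + Complex.I * t 2]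
  map_add' s t := by ext i; fin_cases i <;> simp <;> ring
  map_smul' c t := by ext i; fin_cases i <;> simp <;> ring

/-- The half `(f'(a) + i f(a), f'(-a) - i f(-a))` of the boundary data. -/
noncomputable def minusData : (Fin 4 → ℂ) →ₗ[ℂ] (Fin 2 → ℂ) where
  toFun t := ![t 1 + Complex.I * t 0, t 3 - Complex.I * t 2]
  map_add' s t := by ext i; fin_cases i <;> simp <;> ring
  map_smul' c t := by ext i; fin_cases i <;> simp <;> ring

theorem plusData_apply (t : Fin 4 → ℂ) :
    plusData t = ![t 1 - Complex.I * t 0, t 3 + Complex.I * t 2] := rfl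

theorem minusData_apply (t : Fin 4 → ℂ) :
    minusData t = ![t 1 + Complex.I * t 0, t 3 - Complex.I * t 2] := rfl

theorem bcSubspace_eq (M : Matrix (Fin 2) (Fin 2) ℂ) :
    bcSubspace M = coordGraph plusData minusData M := by
  ext t
  rw [mem_coordGraph]
  rfl

theorem isSplitting_plus_minus : IsSplitting plusData minusData (2 * Complex.I) where
  ne_zero := by simp
  form s t := by
    simp only [plusData_apply, minusData_apply, bdForm_apply, dotProduct, Fin.sum_univ_two,
      Pi.star_apply, Matrix.cons_val_zero, Matrix.cons_val_one, Complex.star_def, map_add, map_sub,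
      map_mul, Complex.conj_I]
    ring
  inj t hp hm := by
    simp only [plusData_apply, minusData_apply, funext_iff, Fin.forall_fin_two,
      Matrix.cons_val_zero, Matrix.cons_val_one, Pi.zero_apply] at hp hm
    have hI := Complex.I_mul_I
    ext i
    fin_cases i
    · simp only [Fin.zero_eta, Pi.zero_apply]
      linear_combination (Complex.I / 2) * (hp.1 - hm.1) + t 0 * hI
    · simp only [Fin.mk_one, Pi.zero_apply]
      linear_combination (hp.1 + hm.1) / 2
    · simp only [Fin.reduceFinMk, Pi.zero_apply]
      linear_combination (Complex.I / 2) * (hm.2 - hp.2) + t 2 * hI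
    · simp only [Fin.reduceFinMk, Pi.zero_apply]
      linear_combination (hp.2 + hm.2) / 2
  surj x y := by
    have hI := Complex.I_mul_I
    refine ⟨![Complex.I / 2 * (x 0 - y 0), (x 0 + y 0) / 2, Complex.I / 2 * (y 1 - x 1),
      (x 1 + y 1) / 2], ?_, ?_⟩
    · ext i
      fin_cases i <;> simp [plusData_apply] 
      · linear_combination (-(x 0 - y 0) / 2) * hI
      · linear_combination ((y 1 - x 1) / 2) * hI
    · ext i
      fin_cases i <;> simp [minusData_apply] 
      · linear_combination ((x 0 - y 0) / 2) * hI
      · linear_combination (-(y 1 - x 1) / 2) * hI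

/-! ### The splitting given by the deficiency spaces -/

/-- Coordinates of boundary data along the vectors `e j`, which are assumed to satisfy
`bdForm (e i) (e j) = z δᵢⱼ`. -/
noncomputable def coordMap (z : ℂ) (e : Fin 2 → Fin 4 → ℂ) : (Fin 4 → ℂ) →ₗ[ℂ] (Fin 2 → ℂ) :=
  LinearMap.pi fun j => z⁻¹ • bdForm (e j)

theorem coordMap_apply (z : ℂ) (e : Fin 2 → Fin 4 → ℂ) (t : Fin 4 → ℂ) (j : Fin 2) :
    coordMap z e t j = z⁻¹ * bdForm (e j) t := rfl

/-- The relations satisfied by the boundary data `τ j` of an orthonormal basis of the deficiency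
space `Ker (A† - i)` and the boundary data `σ j` of one of `Ker (A† + i)`. -/
structure IsDeficiencyFrame (τ σ : Fin 2 → Fin 4 → ℂ) : Prop where
  pos : ∀ i j, bdForm (τ i) (τ j) = if i = j then -(2 * Complex.I) else 0
  neg : ∀ i j, bdForm (σ i) (σ j) = if i = j then 2 * Complex.I else 0
  mixed : ∀ i j, bdForm (τ i) (σ j) = 0

namespace IsDeficiencyFrame

variable {τ σ : Fin 2 → Fin 4 → ℂ}

theorem mixed' (h : IsDeficiencyFrame τ σ) (i j : Fin 2) : bdForm (σ i) (τ j) = 0 := by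
  rw [bdForm_swap, h.mixed, star_zero, neg_zero]

theorem coordMap_combination (h : IsDeficiencyFrame τ σ) (x y : Fin 2 → ℂ) :
    coordMap (-(2 * Complex.I)) τ (∑ j, x j • τ j + ∑ j, y j • σ j) = x ∧
      coordMap (2 * Complex.I) σ (∑ j, x j • τ j + ∑ j, y j • σ j) = y := by
  have h2 : (2 * Complex.I) ≠ 0 := by simp
  constructor <;> ext j <;>
    simp only [coordMap_apply, map_add, map_sum, map_smul, h.pos, h.neg, h.mixed, h.mixed',
      smul_eq_mul, mul_ite, mul_zero, Finset.sum_const_zero, add_zero, zero_add,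
      Finset.sum_ite_eq, Finset.mem_univ, if_true]
  · rw [mul_comm, mul_assoc, mul_inv_cancel₀ (neg_ne_zero.2 h2), mul_one]
  · rw [mul_comm, mul_assoc, mul_inv_cancel₀ h2, mul_one]

/-- The four vectors of boundary data form a basis of `ℂ⁴`. -/
theorem eq_combination (h : IsDeficiencyFrame τ σ) (t : Fin 4 → ℂ) :
    t = ∑ j, coordMap (-(2 * Complex.I)) τ t j • τ j +
      ∑ j, coordMap (2 * Complex.I) σ t j • σ j := by
  let L : ((Fin 2 → ℂ) × (Fin 2 → ℂ)) →ₗ[ℂ] (Fin 4 → ℂ) :=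
    (Fintype.linearCombination ℂ τ).coprod (Fintype.linearCombination ℂ σ)
  have hL (x y : Fin 2 → ℂ) : L (x, y) = ∑ j, x j • τ j + ∑ j, y j • σ j := by
    simp [L, Fintype.linearCombination_apply]
  have hinj : Function.Injective L := by
    rw [injective_iff_map_eq_zero]
    rintro ⟨x, y⟩ hxy
    have hc := h.coordMap_combination x y
    rw [← hL, hxy, map_zero, map_zero] at hc
    exact Prod.ext hc.1.symm hc.2.symm
  have hsurj : Function.Surjective L :=
    (LinearMap.injective_iff_surjective_of_finrank_eq_finrank (by simp)).1 hinj
  obtain ⟨⟨x, y⟩, hxy⟩ := hsurj t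
  have hc := h.coordMap_combination x y
  rw [← hL, hxy] at hc
  rw [hc.1, hc.2, ← hL, hxy]

/-- The coordinates along `τ` and along `σ` form a splitting of the boundary data. -/
theorem isSplitting (h : IsDeficiencyFrame τ σ) :
    IsSplitting (coordMap (-(2 * Complex.I)) τ) (coordMap (2 * Complex.I) σ)
      (-(2 * Complex.I))⁻¹ where
  ne_zero := by simp
  form s t := by
    have h2 : (2 * Complex.I) ≠ 0 := by simp
    have hs (j : Fin 2) : bdForm s (τ j) =
        -(2 * Complex.I) * star (coordMap (-(2 * Complex.I)) τ s j) := by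
      rw [coordMap_apply, bdForm_swap]
      simp
      field_simp
      rw [Complex.I_sq, mul_neg_one]
    have hs' (j : Fin 2) : bdForm s (σ j) =
        2 * Complex.I * star (coordMap (2 * Complex.I) σ s j) := by
      rw [coordMap_apply, bdForm_swap]
      simp
      field_simp
      rw [Complex.I_sq, mul_neg_one]
    conv_rhs => rw [h.eq_combination t]
    simp only [map_add, map_smul, smul_eq_mul, hs, hs', dotProduct, Pi.star_apply,
      Fin.sum_univ_two]
    field_simp
    ring
  inj t hp hm := by
    rw [h.eq_combination t, hp, hm]
    simp
  surj x y := ⟨_, h.coordMap_combination x y⟩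

/-- The boundary data of the functions `G_j`, for a matrix `U`, span the graph of `Uᵀ`. -/
theorem span_eq_coordGraph (h : IsDeficiencyFrame τ σ) (U : Matrix (Fin 2) (Fin 2) ℂ) :
    Submodule.span ℂ (range fun j => τ j + ∑ k, U j k • σ k) =
      coordGraph (coordMap (-(2 * Complex.I)) τ) (coordMap (2 * Complex.I) σ) U.transpose := by
  have hcomb (x : Fin 2 → ℂ) : ∑ j, x j • (τ j + ∑ k, U j k • σ k) =
      ∑ j, x j • τ j + ∑ k, (U.transpose.mulVec x) k • σ k := by
    simp only [Fin.sum_univ_two, Matrix.mulVec, dotProduct, Matrix.transpose_apply]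
    module
  refine le_antisymm (Submodule.span_le.2 ?_) fun t ht => ?_
  · rintro _ ⟨j, rfl⟩
    have := hcomb (Pi.single j 1)
    have he : ∑ i, (Pi.single j 1 : Fin 2 → ℂ) i • (τ i + ∑ k, U i k • σ k) =
        τ j + ∑ k, U j k • σ k := by
      rw [Finset.sum_eq_single j (fun i _ hi => by simp [hi]) (by simp)]
      simp
    rw [he] at this
    simp only [this]
    have hc := h.coordMap_combination (Pi.single j 1) (U.transpose.mulVec (Pi.single j 1))
    rw [SetLike.mem_coe, mem_coordGraph, hc.1, hc.2]
  · rw [h.eq_combination t, mem_coordGraph.1 ht, ← hcomb]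
    exact Submodule.sum_mem _ fun j _ =>
      Submodule.smul_mem _ _ (Submodule.subset_span ⟨j, rfl⟩)

end IsDeficiencyFrame

/-! ### Unitary matrices and unitary maps -/

/-- Unitary matrices `U` correspond to unitary maps `W` by `W (b j) = ∑ k, U j k • b' k`. -/
theorem exists_unitaryEquiv {ι E F : Type*} [Fintype ι] [DecidableEq ι]
    [NormedAddCommGroup E] [InnerProductSpace ℂ E] [NormedAddCommGroup F] [InnerProductSpace ℂ F]
    (b : OrthonormalBasis ι ℂ E) (b' : OrthonormalBasis ι ℂ F) :
    ∃ Θ : Matrix.unitaryGroup ι ℂ ≃ (E ≃ₗᵢ[ℂ] F), ∀ U j,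
      Θ U (b j) = ∑ k, (U : Matrix ι ι ℂ) j k • b' k := by
  have := b'.toBasis.finiteDimensional_of_finite
  have hon (U : Matrix.unitaryGroup ι ℂ) :
      Orthonormal ℂ fun j => ∑ k, (U : Matrix ι ι ℂ) j k • b' k := by
    rw [orthonormal_iff_ite]
    intro i j
    rw [b'.orthonormal.inner_sum]
    have := congrFun (congrFun (Matrix.mem_unitaryGroup_iff.1 U.2) j) i
    rw [Matrix.mul_apply, Matrix.one_apply] at this
    simp only [eq_comm (a := i)]
    rw [← this]
    exact Finset.sum_congr rfl fun k _ => by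
      rw [mul_comm, Matrix.star_apply, starRingEnd_apply]
  have hsp (U : Matrix.unitaryGroup ι ℂ) :
      ⊤ ≤ Submodule.span ℂ (range fun j => ∑ k, (U : Matrix ι ι ℂ) j k • b' k) :=
    ((hon U).linearIndependent.span_eq_top_of_card_eq_finrank'
      (Module.finrank_eq_card_basis b'.toBasis).symm).ge
  let T (U : Matrix.unitaryGroup ι ℂ) : E ≃ₗᵢ[ℂ] F :=
    b.equiv (OrthonormalBasis.mk (hon U) (hsp U)) (Equiv.refl ι)
  have hT (U : Matrix.unitaryGroup ι ℂ) (j : ι) :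
      T U (b j) = ∑ k, (U : Matrix ι ι ℂ) j k • b' k := by simp [T]
  refine ⟨Equiv.ofBijective T ⟨fun U U' hUU => ?_, fun W => ?_⟩, hT⟩
  · ext j k
    have := congrArg (inner ℂ (b' k)) ((hT U j).symm.trans (hUU ▸ hT U' j))
    rwa [b'.orthonormal.inner_right_fintype, b'.orthonormal.inner_right_fintype] at this
  · let U : Matrix ι ι ℂ := Matrix.of fun j k => inner ℂ (b' k) (W (b j))
    have hU : U ∈ Matrix.unitaryGroup ι ℂ := by
      rw [Matrix.mem_unitaryGroup_iff]
      ext i j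
      have h1 := b'.sum_inner_mul_inner (W (b j)) (W (b i))
      rw [W.inner_map_map, orthonormal_iff_ite.1 b.orthonormal] at h1
      rw [Matrix.mul_apply, Matrix.one_apply]
      simp only [eq_comm (a := i)]
      rw [← h1]
      refine Finset.sum_congr rfl fun k _ => ?_
      rw [mul_comm, Matrix.star_apply]
      simp only [U, Matrix.of_apply]
      rw [← starRingEnd_apply, inner_conj_symm]
    refine ⟨⟨U, hU⟩, b.toBasis.ext_linearIsometryEquiv fun j => ?_⟩
    rw [b.coe_toBasis, hT]
    exact b'.sum_repr' _

theorem exists_orthonormalBasis_of_eq_span {H : Type*} [NormedAddCommGroup H]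
    [InnerProductSpace ℂ H] {ι : Type*} [Fintype ι] {K : Submodule ℂ H} {u : ι → H}
    (hu : Orthonormal ℂ u) (hK : K = Submodule.span ℂ (range u)) :
    ∃ b : OrthonormalBasis ι ℂ K, ∀ j, (b j : H) = u j := by
  subst hK
  refine ⟨(Module.Basis.span hu.linearIndependent).toOrthonormalBasis ?_, fun j => ?_⟩
  · convert! orthonormal_span hu
    simp [Module.Basis.span_apply]
  · simp [Module.Basis.span_apply]

/-! ### Extensions of the minimal operator -/

theorem orthogonalBilin_top : (⊤ : Submodule ℂ (Fin 4 → ℂ)).orthogonalBilin bdForm = ⊥ := by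
  refine (Submodule.eq_bot_iff _).2 fun t ht => ?_
  have h (i : Fin 4) := ht (Pi.single i 1) trivial
  have h0 := h 0
  have h1 := h 1
  have h2 := h 2
  have h3 := h 3
  simp [bdForm_apply] at h0 h1 h2 h3
  ext i
  fin_cases i <;> simp_all

section Operator

variable {a : ℝ} {ha : 0 < a} {V : ℝ → ℝ}

/-- Passing to the adjoint amounts to taking the orthogonal complement of the space of boundary data
with respect to the boundary form. -/
theorem adjoint_schrodingerGraph (hVm : AEStronglyMeasurable V (μI a))
    (hVbd : ∃ C : ℝ, ∀ᵐ x ∂(μI a), |V x| ≤ C) (hsurj : ∀ t, ∃ p, (p, t) ∈ traceRel a ha V)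
    (B : Submodule ℂ (Fin 4 → ℂ)) :
    (schrodingerGraph a ha V B).adjoint =
      schrodingerGraph a ha V (B.orthogonalBilin bdForm) := by
  ext q
  rw [Submodule.mem_adjoint_iff, mem_schrodingerGraph_iff]
  constructor
  · intro hq
    obtain ⟨t, -, hqt⟩ := mem_schrodingerGraph_iff.1
      (adjoint_schrodingerGraph_bot_le ha hVm hVbd ((Submodule.mem_adjoint_iff _ q).2
        fun x y hxy => hq x y (schrodingerGraph_mono bot_le hxy)))
    refine ⟨t, fun s hs => ?_, hqt⟩
    obtain ⟨p, hp⟩ := hsurj s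
    rw [← traceRel_green hp hqt]
    exact hq p.1 p.2 (mem_schrodingerGraph_iff.2 ⟨s, hs, hp⟩)
  · rintro ⟨t, ht, hqt⟩ x y hxy
    obtain ⟨s, hs, hp⟩ := mem_schrodingerGraph_iff.1 hxy
    exact (traceRel_green hp hqt).trans (ht s hs)

/-- The operators are densely defined: if `y` is orthogonal to the domain, then `(0, y)` belongs to
the adjoint of the graph of the minimal operator, which is single-valued. -/
theorem dense_domain_schrodinger (hVm : AEStronglyMeasurable V (μI a))
    (hVbd : ∃ C : ℝ, ∀ᵐ x ∂(μI a), |V x| ≤ C) (B : Submodule ℂ (Fin 4 → ℂ)) :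
    Dense ((schrodinger a ha V B).domain : Set (L2I a)) := by
  rw [Submodule.dense_iff_topologicalClosure_eq_top, Submodule.topologicalClosure_eq_top_iff,
    Submodule.eq_bot_iff]
  intro y hy
  refine schrodingerGraph_single (ha := ha) (V := V) (B := ⊤) (0, y) ?_ rfl
  refine adjoint_schrodingerGraph_bot_le ha hVm hVbd
    ((Submodule.mem_adjoint_iff _ _).2 fun x z hxz => ?_)
  have hx : x ∈ (schrodinger a ha V B).domain :=
    ⟨(x, z), schrodingerGraph_mono bot_le hxz, rfl⟩
  simp [(Submodule.mem_orthogonal _ y).1 hy x hx]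

theorem adjoint_schrodinger (hVm : AEStronglyMeasurable V (μI a))
    (hVbd : ∃ C : ℝ, ∀ᵐ x ∂(μI a), |V x| ≤ C) (hsurj : ∀ t, ∃ p, (p, t) ∈ traceRel a ha V)
    (B : Submodule ℂ (Fin 4 → ℂ)) :
    (schrodinger a ha V B).adjoint = schrodinger a ha V (B.orthogonalBilin bdForm) := by
  refine LinearPMap.eq_of_eq_graph ?_
  rw [LinearPMap.adjoint_graph_eq_graph_adjoint (dense_domain_schrodinger hVm hVbd B),
    schrodinger_graph, schrodinger_graph, adjoint_schrodingerGraph hVm hVbd hsurj]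

/-- The adjoint of the minimal operator is the maximal operator. -/
theorem adjoint_minimalOp_graph (hVm : AEStronglyMeasurable V (μI a))
    (hVbd : ∃ C : ℝ, ∀ᵐ x ∂(μI a), |V x| ≤ C) (hsurj : ∀ t, ∃ p, (p, t) ∈ traceRel a ha V) :
    (minimalOp a ha V).adjoint.graph = schrodingerGraph a ha V ⊤ := by
  have h : (⊥ : Submodule ℂ (Fin 4 → ℂ)).orthogonalBilin bdForm = ⊤ := by
    refine (Submodule.eq_top_iff').2 fun t s hs => ?_
    rw [(Submodule.mem_bot ℂ).1 hs, map_zero, LinearMap.zero_apply]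
  rw [minimalOp, adjoint_schrodinger hVm hVbd hsurj, schrodinger_graph, h]

/-- The minimal operator is closed, being the adjoint of the maximal operator. -/
theorem closure_minimalOp (hVm : AEStronglyMeasurable V (μI a))
    (hVbd : ∃ C : ℝ, ∀ᵐ x ∂(μI a), |V x| ≤ C) (hsurj : ∀ t, ∃ p, (p, t) ∈ traceRel a ha V) :
    (minimalOp a ha V).closure = minimalOp a ha V := by
  have hc : (minimalOp a ha V).IsClosed := by
    rw [minimalOp, ← orthogonalBilin_top, ← adjoint_schrodinger hVm hVbd hsurj]
    exact LinearPMap.adjoint_isClosed (dense_domain_schrodinger hVm hVbd ⊤)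
  refine LinearPMap.eq_of_eq_graph ?_
  rw [← hc.isClosable.graph_closure_eq_closure_graph]
  exact hc.submodule_topologicalClosure_eq

theorem isSelfAdjoint_schrodinger (hVm : AEStronglyMeasurable V (μI a))
    (hVbd : ∃ C : ℝ, ∀ᵐ x ∂(μI a), |V x| ≤ C) (hsurj : ∀ t, ∃ p, (p, t) ∈ traceRel a ha V)
    {B : Submodule ℂ (Fin 4 → ℂ)} (hB : IsLagrangian B) :
    IsSelfAdjoint (schrodinger a ha V B) := by
  rw [LinearPMap.isSelfAdjoint_def, adjoint_schrodinger hVm hVbd hsurj, hB]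

theorem schrodinger_mono {B C : Submodule ℂ (Fin 4 → ℂ)} (h : B ≤ C) :
    schrodinger a ha V B ≤ schrodinger a ha V C := by
  refine LinearPMap.le_of_le_graph ?_
  rw [schrodinger_graph, schrodinger_graph]
  exact schrodingerGraph_mono h

/-- Since all boundary data occur, the operator determines its boundary condition. -/
theorem schrodinger_injective (hsurj : ∀ t, ∃ p, (p, t) ∈ traceRel a ha V) :
    Function.Injective (schrodinger a ha V) := by
  have key {B C : Submodule ℂ (Fin 4 → ℂ)} (h : schrodinger a ha V B = schrodinger a ha V C) :
      B ≤ C := by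
    intro t ht
    obtain ⟨p, hp⟩ := hsurj t
    have hpB : p ∈ (schrodinger a ha V B).graph := by
      rw [schrodinger_graph]
      exact mem_schrodingerGraph_iff.2 ⟨t, ht, hp⟩
    rw [h, schrodinger_graph] at hpB
    obtain ⟨s, hs, hps⟩ := mem_schrodingerGraph_iff.1 hpB
    rwa [traceRel_unique hp hps rfl]
  exact fun B C h => le_antisymm (key h) (key h.symm)

/-- A self-adjoint extension of the minimal operator is a restriction of its adjoint, hence given
by the subspace of the boundary data of its domain, which is Lagrangian. -/
theorem exists_lagrangian_of_isSelfAdjoint (hVm : AEStronglyMeasurable V (μI a))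
    (hVbd : ∃ C : ℝ, ∀ᵐ x ∂(μI a), |V x| ≤ C) (hsurj : ∀ t, ∃ p, (p, t) ∈ traceRel a ha V)
    {S : L2I a →ₗ.[ℂ] L2I a} (hle : minimalOp a ha V ≤ S) (hS : IsSelfAdjoint S) :
    ∃ B, IsLagrangian B ∧ S = schrodinger a ha V B := by
  have hbot : schrodingerGraph a ha V ⊥ ≤ S.graph := by
    rw [← schrodinger_graph]
    exact LinearPMap.le_graph_of_le hle
  have hSadj : S.graph.adjoint = S.graph := by
    rw [← LinearPMap.adjoint_graph_eq_graph_adjoint hS.dense_domain,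
      LinearPMap.isSelfAdjoint_def.1 hS]
  have htop : S.graph ≤ schrodingerGraph a ha V ⊤ := by
    intro q hq
    rw [← hSadj, Submodule.mem_adjoint_iff] at hq
    exact adjoint_schrodingerGraph_bot_le ha hVm hVbd
      ((Submodule.mem_adjoint_iff _ q).2 fun x y hxy => hq x y (hbot hxy))
  let B : Submodule ℂ (Fin 4 → ℂ) :=
    (traceRel a ha V ⊓ S.graph.comap (LinearMap.fst ℂ _ _)).map (LinearMap.snd ℂ _ _)
  have hSB : S = schrodinger a ha V B := by
    refine LinearPMap.eq_of_eq_graph ?_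
    rw [schrodinger_graph]
    ext p
    rw [mem_schrodingerGraph_iff]
    constructor
    · intro hp
      obtain ⟨t, -, hpt⟩ := mem_schrodingerGraph_iff.1 (htop hp)
      exact ⟨t, ⟨(p, t), ⟨hpt, hp⟩, rfl⟩, hpt⟩
    · rintro ⟨t, ⟨⟨q, t'⟩, ⟨hqt, hq⟩, rfl⟩, hpt⟩
      have hd : p - q ∈ schrodingerGraph a ha V ⊥ := by
        rw [mem_schrodingerGraph_bot]
        simpa using (traceRel a ha V).sub_mem hpt hqt
      have := S.graph.add_mem (hbot hd) hq
      rwa [LinearMap.fst_apply, sub_add_cancel] at this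
  refine ⟨B, schrodinger_injective (ha := ha) (V := V) hsurj ?_, hSB⟩
  rw [← adjoint_schrodinger hVm hVbd hsurj, ← hSB]
  exact hS

/-! ### The deficiency spaces -/

theorem mem_deficiencySpace_minimalOp (hVm : AEStronglyMeasurable V (μI a))
    (hVbd : ∃ C : ℝ, ∀ᵐ x ∂(μI a), |V x| ≤ C) (hsurj : ∀ t, ∃ p, (p, t) ∈ traceRel a ha V)
    {z : ℂ} {φ : L2I a} :
    φ ∈ deficiencySpace (minimalOp a ha V) z ↔ ∃ t, ((φ, z • φ), t) ∈ traceRel a ha V := by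
  rw [deficiencySpace, Submodule.mem_comap, adjoint_minimalOp_graph hVm hVbd hsurj,
    mem_schrodingerGraph_iff]
  simp

/-- The minimal operator, being symmetric, has no eigenvalue off the real axis. -/
theorem eq_zero_of_eigen {z : ℂ} (hz : star z ≠ z) {φ : L2I a}
    (h : ((φ, z • φ), (0 : Fin 4 → ℂ)) ∈ traceRel a ha V) : φ = 0 := by
  have hg := traceRel_green h h
  rw [map_zero, inner_smul_left, inner_smul_right, ← sub_mul,
    mul_eq_zero, sub_eq_zero] at hg
  exact inner_self_eq_zero.1 (hg.resolve_left hz)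

/-- If the boundary data of every element of `Ker (A† - z)` are combinations of those of the `u j`,
then the `u j` span `Ker (A† - z)`: the difference of an element and a combination of the `u j` with
the same boundary data is an eigenvector of the minimal operator. -/
theorem deficiencySpace_eq_span (hVm : AEStronglyMeasurable V (μI a))
    (hVbd : ∃ C : ℝ, ∀ᵐ x ∂(μI a), |V x| ≤ C) (hsurj : ∀ t, ∃ p, (p, t) ∈ traceRel a ha V)
    {z : ℂ} (hz : star z ≠ z) {u : Fin 2 → L2I a} {e : Fin 2 → Fin 4 → ℂ}
    (hu : ∀ j, ((u j, z • u j), e j) ∈ traceRel a ha V)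
    (he : ∀ (φ : L2I a) (t : Fin 4 → ℂ), ((φ, z • φ), t) ∈ traceRel a ha V →
      ∃ c : Fin 2 → ℂ, t = ∑ j, c j • e j) :
    deficiencySpace (minimalOp a ha V) z = Submodule.span ℂ (range u) := by
  refine le_antisymm (fun φ hφ => ?_) (Submodule.span_le.2 ?_)
  · obtain ⟨t, ht⟩ := (mem_deficiencySpace_minimalOp hVm hVbd hsurj).1 hφ
    obtain ⟨c, rfl⟩ := he φ t ht
    have hs := (traceRel a ha V).sub_mem ht
      ((traceRel a ha V).sum_mem fun j (_ : j ∈ Finset.univ) =>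
        (traceRel a ha V).smul_mem (c j) (hu j))
    have h0 : φ - ∑ j, c j • u j = 0 := by
      refine eq_zero_of_eigen (ha := ha) (V := V) hz ?_
      convert! hs using 1
      simp only [Fin.sum_univ_two, Prod.smul_mk, Prod.mk_add_mk, Prod.mk_sub_mk, sub_self,
        Prod.mk.injEq, and_true, true_and]
      module
    rw [sub_eq_zero.1 h0]
    exact Submodule.sum_mem _ fun j _ => Submodule.smul_mem _ _ (Submodule.subset_span ⟨j, rfl⟩)
  · rintro _ ⟨j, rfl⟩
    exact (mem_deficiencySpace_minimalOp hVm hVbd hsurj).2 ⟨_, hu j⟩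

/-! ### The von Neumann extensions -/

theorem mem_graph_domRestrict {H : Type*} [NormedAddCommGroup H] [InnerProductSpace ℂ H]
    {T : H →ₗ.[ℂ] H} {D : Submodule ℂ H} {p : H × H} :
    p ∈ (T.domRestrict D).graph ↔ p ∈ T.graph ∧ p.1 ∈ D := by
  constructor
  · intro hp
    refine ⟨LinearPMap.le_graph_of_le LinearPMap.domRestrict_le hp, ?_⟩
    exact (LinearPMap.mem_domain_of_mem_graph hp).1
  · rintro ⟨hp, hD⟩
    have hx : p.1 ∈ (T.domRestrict D).domain := ⟨hD, LinearPMap.mem_domain_of_mem_graph hp⟩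
    have h := (T.domRestrict D).mem_graph ⟨p.1, hx⟩
    have h' := T.mem_graph_snd_inj' hp (LinearPMap.le_graph_of_le LinearPMap.domRestrict_le h) rfl
    have hp' : p = (p.1, T.domRestrict D ⟨p.1, hx⟩) := Prod.ext rfl h'
    rwa [hp']

/-- The von Neumann extension given by `W` is the operator whose boundary data are spanned by
those of the `φ + W φ`, for `φ` in a spanning family `u` of the deficiency space. -/
theorem vonNeumannExt_eq_schrodinger (hVm : AEStronglyMeasurable V (μI a))
    (hVbd : ∃ C : ℝ, ∀ᵐ x ∂(μI a), |V x| ≤ C) (hsurj : ∀ t, ∃ p, (p, t) ∈ traceRel a ha V)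
    {u : Fin 2 → L2I a} {e : Fin 2 → Fin 4 → ℂ}
    (hspan : deficiencySpace (minimalOp a ha V) Complex.I = Submodule.span ℂ (range u))
    (W : deficiencySpace (minimalOp a ha V) Complex.I ≃ₗᵢ[ℂ]
      deficiencySpace (minimalOp a ha V) (-Complex.I))
    (he : ∀ j (φ : deficiencySpace (minimalOp a ha V) Complex.I), (φ : L2I a) = u j →
      ∃ y, ((u j + (W φ : L2I a), y), e j) ∈ traceRel a ha V) :
    vonNeumannExt (minimalOp a ha V) W =
      schrodinger a ha V (Submodule.span ℂ (range e)) := by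
  have hmem (j : Fin 2) : u j ∈ deficiencySpace (minimalOp a ha V) Complex.I := by
    rw [hspan]
    exact Submodule.subset_span ⟨j, rfl⟩
  let φ (j : Fin 2) : deficiencySpace (minimalOp a ha V) Complex.I := ⟨u j, hmem j⟩
  have hy (j : Fin 2) := he j (φ j) rfl
  choose y hy using hy
  let N : deficiencySpace (minimalOp a ha V) Complex.I →ₗ[ℂ] L2I a :=
    (deficiencySpace (minimalOp a ha V) Complex.I).subtype +
      (deficiencySpace (minimalOp a ha V) (-Complex.I)).subtype ∘ₗ W.toLinearEquiv.toLinearMap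
  have hNφ (j : Fin 2) : N (φ j) = u j + (W (φ j) : L2I a) := rfl
  have hN (c : Fin 2 → ℂ) : ((N (∑ j, c j • φ j), ∑ j, c j • y j), ∑ j, c j • e j) ∈
      traceRel a ha V := by
    have := (traceRel a ha V).sum_mem fun j (_ : j ∈ Finset.univ) =>
      (traceRel a ha V).smul_mem (c j) (hy j)
    convert! this using 1
    rw [map_sum]
    simp only [map_smul, hNφ, Fin.sum_univ_two, Prod.smul_mk, Prod.mk_add_mk]
  refine LinearPMap.eq_of_eq_graph ?_
  rw [schrodinger_graph]
  ext p
  rw [vonNeumannExt, mem_graph_domRestrict, adjoint_minimalOp_graph hVm hVbd hsurj,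
    closure_minimalOp hVm hVbd hsurj]
  change _ ∧ p.1 ∈ (minimalOp a ha V).domain ⊔ LinearMap.range N ↔ _
  constructor
  · rintro ⟨hp, hD⟩
    obtain ⟨x, ⟨q, hq, rfl⟩, _, ⟨ψ, rfl⟩, hx⟩ := Submodule.mem_sup.1 hD
    have hψ : (ψ : L2I a) ∈ Submodule.span ℂ (range u) := hspan ▸ ψ.2
    obtain ⟨c, hc⟩ := (Submodule.mem_span_range_iff_exists_fun ℂ).1 hψ
    have hψ' : ψ = ∑ j, c j • φ j := Subtype.ext (by simp [← hc, φ])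
    obtain ⟨s, -, hps⟩ := mem_schrodingerGraph_iff.1 hp
    have hsum := (traceRel a ha V).add_mem (mem_schrodingerGraph_bot.1 hq) (hN c)
    have hs : s = 0 + ∑ j, c j • e j := by
      refine traceRel_unique hps hsum ?_
      rw [← hx, hψ']
      rfl
    refine mem_schrodingerGraph_iff.2 ⟨s, ?_, hps⟩
    rw [hs, zero_add]
    exact Submodule.sum_mem _ fun j _ => Submodule.smul_mem _ _ (Submodule.subset_span ⟨j, rfl⟩)
  · intro hp
    obtain ⟨s, hs, hps⟩ := mem_schrodingerGraph_iff.1 hp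
    obtain ⟨c, rfl⟩ := (Submodule.mem_span_range_iff_exists_fun ℂ).1 hs
    refine ⟨schrodingerGraph_mono le_top hp, ?_⟩
    have hsub := (traceRel a ha V).sub_mem hps (hN c)
    rw [Prod.mk_sub_mk, sub_self] at hsub
    refine Submodule.mem_sup.2 ⟨_, ⟨_, mem_schrodingerGraph_bot.2 hsub, rfl⟩, _,
      ⟨∑ j, c j • φ j, rfl⟩, ?_⟩
    simp

end Operator

/-! ### Solutions of the eigenvalue equations -/

section Solutions

variable {a : ℝ} {ha : 0 < a} {V : ℝ → ℝ}

theorem traceRel_of_expr_eq {f : ℝ → ℂ} (hf : IsAC2 a f) {z : ℂ}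
    (h : ∀ᵐ x ∂(μI a), expr a V f x = z * f x) :
    ((hf.toL2, z • hf.toL2), traces a f) ∈ traceRel a ha V := by
  refine ⟨f, hf, rfl, hf.memLp_self.coeFn_toLp, ?_⟩
  filter_upwards [Lp.coeFn_smul z hf.toL2, hf.memLp_self.coeFn_toLp, h] with x h1 h2 h3
  rw [h1, h3, Pi.smul_apply, IsAC2.toL2, h2, smul_eq_mul]

/-- Since `V` is real, the relation is invariant under complex conjugation. -/
theorem traceRel_star {p : L2I a × L2I a} {t : Fin 4 → ℂ} (h : (p, t) ∈ traceRel a ha V) :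
    ((star p.1, star p.2), star t) ∈ traceRel a ha V := by
  obtain ⟨f, hf, rfl, h1, h2⟩ := h
  refine ⟨star f, hf.star, traces_star a f, ?_, ?_⟩
  · filter_upwards [Lp.coeFn_star p.1, h1] with x hx hx1
    rw [hx, Pi.star_apply, hx1, Pi.star_apply]
  · rw [expr_star]
    filter_upwards [Lp.coeFn_star p.2, h2] with x hx hx1
    rw [hx, Pi.star_apply, hx1, Pi.star_apply]

theorem star_smul_L2 (z : ℂ) (φ : L2I a) : star (z • φ) = star z • star φ := by
  refine Lp.ext ?_
  filter_upwards [Lp.coeFn_star (z • φ), Lp.coeFn_smul z φ, Lp.coeFn_smul (star z) (star φ),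
    Lp.coeFn_star φ] with x h1 h2 h3 h4
  rw [h1, Pi.star_apply, h2, h3, Pi.smul_apply, Pi.smul_apply, h4, Pi.star_apply, star_smul]

theorem traceRel_star_eigen {φ : L2I a} {t : Fin 4 → ℂ}
    (h : ((φ, Complex.I • φ), t) ∈ traceRel a ha V) :
    ((star φ, -Complex.I • star φ), star t) ∈ traceRel a ha V := by
  have := traceRel_star h
  rwa [star_smul_L2, Complex.star_def, Complex.conj_I] at this

/-- The boundary form on the boundary data of two solutions, by Green's identity. -/
theorem bdForm_eigen {φ ψ : L2I a} {s t : Fin 4 → ℂ} {z w : ℂ}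
    (hs : ((φ, z • φ), s) ∈ traceRel a ha V) (ht : ((ψ, w • ψ), t) ∈ traceRel a ha V) :
    bdForm s t = (star z - w) * inner ℂ φ ψ := by
  rw [← traceRel_green hs ht, inner_smul_left, inner_smul_right, sub_mul]
  rfl

/-- Green's identity turns the orthonormality of solutions `u j` for `i` into the frame relations
for their boundary data and the conjugates of these. -/
theorem isDeficiencyFrame_of_orthonormal {u : Fin 2 → L2I a} {τ : Fin 2 → Fin 4 → ℂ}
    (hu : Orthonormal ℂ u) (hτ : ∀ j, ((u j, Complex.I • u j), τ j) ∈ traceRel a ha V) :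
    IsDeficiencyFrame τ fun j => star (τ j) := by
  have hpos (i j : Fin 2) : bdForm (τ i) (τ j) = if i = j then -(2 * Complex.I) else 0 := by
    rw [bdForm_eigen (hτ i) (hτ j), orthonormal_iff_ite.1 hu, Complex.star_def, Complex.conj_I]
    split_ifs <;> ring
  refine ⟨hpos, fun i j => ?_, fun i j => ?_⟩
  · rw [bdForm_star, hpos]
    split_ifs <;> simp
  · rw [bdForm_eigen (hτ i) (traceRel_star_eigen (hτ j)), Complex.star_def, Complex.conj_I,
      sub_self, zero_mul]

theorem orthonormal_star {u : Fin 2 → L2I a} {τ : Fin 2 → Fin 4 → ℂ}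
    (hu : Orthonormal ℂ u) (hτ : ∀ j, ((u j, Complex.I • u j), τ j) ∈ traceRel a ha V) :
    Orthonormal ℂ fun j => star (u j) := by
  rw [orthonormal_iff_ite]
  intro i j
  have h := (isDeficiencyFrame_of_orthonormal hu hτ).neg i j
  rw [bdForm_eigen (traceRel_star_eigen (hτ i)) (traceRel_star_eigen (hτ j)), star_neg,
    Complex.star_def, Complex.conj_I] at h
  have h2 : (2 * Complex.I) ≠ 0 := by simp
  refine mul_left_cancel₀ h2 ?_
  rw [mul_ite, mul_one, mul_zero, ← h]
  ring

theorem exists_mem_traceRel {q : (L2I a × L2I a) × (Fin 4 → ℂ)} (hq : q ∈ traceRel a ha V)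
    {t : Fin 4 → ℂ} (ht : q.2 = t) : ∃ p, (p, t) ∈ traceRel a ha V :=
  ⟨q.1, by rwa [← ht]⟩

theorem exists_snd_mem_traceRel {q : (L2I a × L2I a) × (Fin 4 → ℂ)} (hq : q ∈ traceRel a ha V)
    {x : L2I a} {t : Fin 4 → ℂ} (hx : q.1.1 = x) (ht : q.2 = t) :
    ∃ y, ((x, y), t) ∈ traceRel a ha V :=
  ⟨q.1.2, by rwa [← hx, ← ht]⟩

/-- All boundary data occur, since those of the deficiency solutions already span `ℂ⁴`. -/
theorem IsDeficiencyFrame.exists_traceRel {τ σ : Fin 2 → Fin 4 → ℂ} (h : IsDeficiencyFrame τ σ)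
    (hτ : ∀ j, ∃ p, (p, τ j) ∈ traceRel a ha V) (hσ : ∀ j, ∃ p, (p, σ j) ∈ traceRel a ha V)
    (t : Fin 4 → ℂ) : ∃ p, (p, t) ∈ traceRel a ha V := by
  choose p hp using hτ
  choose q hq using hσ
  have hm := (traceRel a ha V).add_mem
    ((traceRel a ha V).sum_mem fun j (_ : j ∈ Finset.univ) => (traceRel a ha V).smul_mem
      (coordMap (-(2 * Complex.I)) τ t j) (hp j))
    ((traceRel a ha V).sum_mem fun j (_ : j ∈ Finset.univ) => (traceRel a ha V).smul_mem
      (coordMap (2 * Complex.I) σ t j) (hq j))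
  refine exists_mem_traceRel hm ?_
  refine Eq.trans ?_ (h.eq_combination t).symm
  simp only [Prod.snd_add, Prod.snd_sum, Prod.smul_snd]

/-- The boundary data of a solution for `i` are orthogonal to those of every solution for `-i`, so
their coordinates along the latter vanish. -/
theorem deficiencySpaces_eq_span (hVm : AEStronglyMeasurable V (μI a))
    (hVbd : ∃ C : ℝ, ∀ᵐ x ∂(μI a), |V x| ≤ C) (hsurj : ∀ t, ∃ p, (p, t) ∈ traceRel a ha V)
    {u : Fin 2 → L2I a} {τ : Fin 2 → Fin 4 → ℂ} (hu : Orthonormal ℂ u)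
    (hτ : ∀ j, ((u j, Complex.I • u j), τ j) ∈ traceRel a ha V) :
    deficiencySpace (minimalOp a ha V) Complex.I = Submodule.span ℂ (range u) ∧
    deficiencySpace (minimalOp a ha V) (-Complex.I) =
      Submodule.span ℂ (range fun j => star (u j)) := by
  have h := isDeficiencyFrame_of_orthonormal hu hτ
  have hI : -Complex.I ≠ Complex.I := by
    simp [neg_eq_iff_add_eq_zero, ← two_mul]
  constructor
  · refine deficiencySpace_eq_span hVm hVbd hsurj (by simpa using hI) hτ fun φ t ht =>
      ⟨coordMap (-(2 * Complex.I)) τ t, ?_⟩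
    have h0 : coordMap (2 * Complex.I) (fun j => star (τ j)) t = 0 := by
      ext j
      rw [coordMap_apply, bdForm_eigen (traceRel_star_eigen (hτ j)) ht]
      simp
    conv_lhs => rw [h.eq_combination t, h0]
    simp
  · refine deficiencySpace_eq_span hVm hVbd hsurj (by simpa using hI.symm)
      (fun j => traceRel_star_eigen (hτ j)) fun φ t ht =>
        ⟨coordMap (2 * Complex.I) (fun j => star (τ j)) t, ?_⟩
    have h0 : coordMap (-(2 * Complex.I)) τ t = 0 := by
      ext j
      rw [coordMap_apply, bdForm_eigen (hτ j) ht]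
      simp
    conv_lhs => rw [h.eq_combination t, h0]
    simp

end Solutions

/-! ### The boundary data of the functions `G_j` -/

theorem traces_G {a : ℝ} (ha : 0 < a) {g : Fin 2 → ℝ → ℂ} (hg : ∀ j, IsAC2 a (g j))
    (U : Matrix (Fin 2) (Fin 2) ℂ) (j : Fin 2) :
    traces a (G g U j) = traces a (g j) + ∑ k, U j k • star (traces a (g k)) := by
  have hG : G g U j = g j + (U j 0 • star (g 0) + U j 1 • star (g 1)) := by
    funext x
    simp [G, Fin.sum_univ_two]
  rw [hG, traces_add ha (hg j) (((hg 0).star.smul _).add ha ((hg 1).star.smul _)),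
    traces_add ha ((hg 0).star.smul _) ((hg 1).star.smul _), traces_smul, traces_smul,
    traces_star, traces_star, Fin.sum_univ_two]

theorem transpose_mem_unitaryGroup {U : Matrix (Fin 2) (Fin 2) ℂ} :
    U.transpose ∈ Matrix.unitaryGroup (Fin 2) ℂ ↔ U ∈ Matrix.unitaryGroup (Fin 2) ℂ := by
  have key {W : Matrix (Fin 2) (Fin 2) ℂ} (hW : W ∈ Matrix.unitaryGroup (Fin 2) ℂ) :
      W.transpose ∈ Matrix.unitaryGroup (Fin 2) ℂ := by
    rw [Matrix.mem_unitaryGroup_iff]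
    have := congrArg Matrix.transpose (Matrix.mem_unitaryGroup_iff'.1 hW)
    rwa [Matrix.transpose_mul, Matrix.transpose_one] at this
  exact ⟨fun h => by simpa using key h, key⟩

/-- Transposition of unitary matrices. -/
def unitaryTranspose :
    Matrix.unitaryGroup (Fin 2) ℂ ≃ Matrix.unitaryGroup (Fin 2) ℂ where
  toFun U := ⟨(U : Matrix (Fin 2) (Fin 2) ℂ).transpose, transpose_mem_unitaryGroup.2 U.2⟩
  invFun U := ⟨(U : Matrix (Fin 2) (Fin 2) ℂ).transpose, transpose_mem_unitaryGroup.2 U.2⟩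
  left_inv _ := rfl
  right_inv _ := rfl

namespace IsDeficiencyFrame

variable {τ σ : Fin 2 → Fin 4 → ℂ}

/-- The bijection of the unitary matrices `U` onto the unitary matrices `M` for which the graph of
`Uᵀ` in the deficiency splitting and the graph of `M` in the splitting of the boundary conditions
are the same Lagrangian subspace. -/
noncomputable def bcEquiv (h : IsDeficiencyFrame τ σ) :
    Matrix.unitaryGroup (Fin 2) ℂ ≃ Matrix.unitaryGroup (Fin 2) ℂ :=
  (unitaryTranspose.trans h.isSplitting.lagrangianEquiv).trans
    isSplitting_plus_minus.lagrangianEquiv.symm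

theorem bcSubspace_bcEquiv (h : IsDeficiencyFrame τ σ) (U : Matrix.unitaryGroup (Fin 2) ℂ) :
    bcSubspace (h.bcEquiv U : Matrix (Fin 2) (Fin 2) ℂ) = Submodule.span ℂ
      (range fun j => τ j + ∑ k, (U : Matrix (Fin 2) (Fin 2) ℂ) j k • σ k) := by
  rw [bcSubspace_eq, ← isSplitting_plus_minus.coe_lagrangianEquiv, h.span_eq_coordGraph]
  simp only [bcEquiv, Equiv.trans_apply, Equiv.apply_symm_apply]
  rfl

/-- Only a unitary `U` can satisfy a unitary boundary condition `M`, since the subspace of `M` is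
the graph of some unitary matrix in the deficiency splitting, and a graph contains no other graph. -/
theorem mem_bcSubspace_iff (h : IsDeficiencyFrame τ σ) (U : Matrix (Fin 2) (Fin 2) ℂ)
    (M : Matrix.unitaryGroup (Fin 2) ℂ) :
    (∀ j, τ j + ∑ k, U j k • σ k ∈ bcSubspace (M : Matrix (Fin 2) (Fin 2) ℂ)) ↔
      ∃ hU : U ∈ Matrix.unitaryGroup (Fin 2) ℂ, h.bcEquiv ⟨U, hU⟩ = M := by
  constructor
  · intro hj
    obtain ⟨U', rfl⟩ := h.bcEquiv.surjective M
    have hle : Submodule.span ℂ (range fun j => τ j + ∑ k, U j k • σ k) ≤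
        bcSubspace (h.bcEquiv U' : Matrix (Fin 2) (Fin 2) ℂ) := by
      rw [Submodule.span_le]
      rintro _ ⟨j, rfl⟩
      exact hj j
    rw [h.bcSubspace_bcEquiv, h.span_eq_coordGraph, h.span_eq_coordGraph] at hle
    have hUU := Matrix.transpose_injective (h.isSplitting.eq_of_coordGraph_le hle)
    exact ⟨hUU ▸ U'.2, congrArg _ (Subtype.ext hUU)⟩
  · rintro ⟨hU, rfl⟩ j
    rw [h.bcSubspace_bcEquiv]
    exact Submodule.subset_span ⟨j, rfl⟩

/-- In a unitary boundary condition each half of the boundary data determines the other, so both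
halves are injective on the span of the boundary data of the `G_j`. -/
theorem linearIndependent_data (h : IsDeficiencyFrame τ σ) {U : Matrix (Fin 2) (Fin 2) ℂ}
    (hU : U ∈ Matrix.unitaryGroup (Fin 2) ℂ) :
    LinearIndependent ℂ (fun j => plusData (τ j + ∑ k, U j k • σ k)) ∧
      LinearIndependent ℂ (fun j => minusData (τ j + ∑ k, U j k • σ k)) := by
  set M := h.bcEquiv ⟨U, hU⟩
  have hMU : bcSubspace (M : Matrix (Fin 2) (Fin 2) ℂ) =
    Submodule.span ℂ (range fun j => τ j + ∑ k, U j k • σ k) := h.bcSubspace_bcEquiv _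
  have hli : LinearIndependent ℂ (fun j => τ j + ∑ k, U j k • σ k) := by
    rw [Fintype.linearIndependent_iff]
    intro x hx
    have hc : coordMap (-(2 * Complex.I)) τ (∑ j, x j • (τ j + ∑ k, U j k • σ k)) = x := by
      refine Eq.trans (congrArg _ ?_) (h.coordMap_combination x (U.transpose.mulVec x)).1
      simp only [Fin.sum_univ_two, Matrix.mulVec, dotProduct, Matrix.transpose_apply]
      module
    rw [hx, map_zero] at hc
    exact fun i => (congrFun hc i).symm
  have hM (t) (ht : t ∈ Submodule.span ℂ (range fun j => τ j + ∑ k, U j k • σ k)) :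
      minusData t = (M : Matrix (Fin 2) (Fin 2) ℂ).mulVec (plusData t) := by
    rwa [← hMU, bcSubspace_eq, mem_coordGraph] at ht
  constructor
  · refine hli.map (Submodule.disjoint_def.2 fun t ht ht' => ?_)
    refine isSplitting_plus_minus.inj t ht' ?_
    rw [hM t ht, LinearMap.mem_ker.1 ht', Matrix.mulVec_zero]
  · refine hli.map (Submodule.disjoint_def.2 fun t ht ht' => ?_)
    refine isSplitting_plus_minus.inj t ?_ ht'
    have := congrArg (star (M : Matrix (Fin 2) (Fin 2) ℂ)).mulVec (hM t ht)
    rwa [LinearMap.mem_ker.1 ht', Matrix.mulVec_zero, Matrix.mulVec_mulVec,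
      Matrix.mem_unitaryGroup_iff'.1 M.2, Matrix.one_mulVec, eq_comm] at this

end IsDeficiencyFrame

end SchrodingerBC

theorem mainTheorem2 (a : ℝ) (ha : 0 < a) (V : ℝ → ℝ)
    -- `V` is piecewise continuous on `[-a, a]`, and multiplication by `V` is bounded
    (hVpc : ∃ S : Set ℝ, S.Finite ∧
      ∀ x ∈ Set.Icc (-a) a \ S, ContinuousWithinAt V (Set.Icc (-a) a) x)
    (hVbd : ∃ C : ℝ, ∀ᵐ x ∂(SchrodingerBC.μI a), |V x| ≤ C)
    -- `g 0`, `g 1` are orthonormal solutions of `-g'' + V g = i g`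
    (g : Fin 2 → ℝ → ℂ) (hg : ∀ j, SchrodingerBC.IsAC2 a (g j))
    (hsol : ∀ j, ∀ᵐ x ∂(SchrodingerBC.μI a),
      SchrodingerBC.expr a V (g j) x = Complex.I * g j x)
    (horth : Orthonormal ℂ fun j => (hg j).toL2) :
    -- the deficiency spaces of `A`
    SchrodingerBC.deficiencySpace (SchrodingerBC.minimalOp a ha V) Complex.I =
      Submodule.span ℂ (Set.range fun j => (hg j).toL2) ∧
    SchrodingerBC.deficiencySpace (SchrodingerBC.minimalOp a ha V) (-Complex.I) =
      Submodule.span ℂ (Set.range fun j => star (hg j).toL2) ∧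
    -- for unitary `U` the vectors `z_j⁽⁺⁾`, and likewise the `z_j⁽⁻⁾`, are linearly independent
    (∀ U ∈ Matrix.unitaryGroup (Fin 2) ℂ,
      LinearIndependent ℂ (SchrodingerBC.zPlus a g U) ∧
      LinearIndependent ℂ (SchrodingerBC.zMinus a g U)) ∧
    -- the unitary maps `Ker (A† - i) → Ker (A† + i)` are parametrized by the unitary matrices `U`
    ∃ Θ : Matrix.unitaryGroup (Fin 2) ℂ ≃
        (SchrodingerBC.deficiencySpace (SchrodingerBC.minimalOp a ha V) Complex.I ≃ₗᵢ[ℂ]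
          SchrodingerBC.deficiencySpace (SchrodingerBC.minimalOp a ha V) (-Complex.I)),
      (∀ (U : Matrix.unitaryGroup (Fin 2) ℂ) (j : Fin 2)
        (φ : SchrodingerBC.deficiencySpace (SchrodingerBC.minimalOp a ha V) Complex.I),
        (φ : SchrodingerBC.L2I a) = (hg j).toL2 →
          (Θ U φ : SchrodingerBC.L2I a) =
            ∑ k, (U : Matrix (Fin 2) (Fin 2) ℂ) j k • star (hg k).toL2) ∧
      -- the von Neumann extensions `A_U` are exactly the self-adjoint extensions of `A`,
      -- each obtained from exactly one `U`
      Function.Injective (fun U =>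
        SchrodingerBC.vonNeumannExt (SchrodingerBC.minimalOp a ha V) (Θ U)) ∧
      Set.range (fun U =>
        SchrodingerBC.vonNeumannExt (SchrodingerBC.minimalOp a ha V) (Θ U)) =
        {S | SchrodingerBC.minimalOp a ha V ≤ S ∧ IsSelfAdjoint S} ∧
      -- the bijection `U ↦ 𝒰` of the unitary matrices, determined by `z_j⁽⁻⁾ = 𝒰 z_j⁽⁺⁾`
      ∃ Φ : Matrix.unitaryGroup (Fin 2) ℂ ≃ Matrix.unitaryGroup (Fin 2) ℂ,
        (∀ (U : Matrix (Fin 2) (Fin 2) ℂ) (M : Matrix.unitaryGroup (Fin 2) ℂ),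
          (∀ j, SchrodingerBC.zMinus a g U j =
            (M : Matrix (Fin 2) (Fin 2) ℂ).mulVec (SchrodingerBC.zPlus a g U j)) ↔
          ∃ hU : U ∈ Matrix.unitaryGroup (Fin 2) ℂ, Φ ⟨U, hU⟩ = M) ∧
        -- `A_U` is the operator with the boundary condition given by `𝒰`
        (∀ U, SchrodingerBC.vonNeumannExt (SchrodingerBC.minimalOp a ha V) (Θ U) =
          SchrodingerBC.bcOp a ha V (Φ U : Matrix (Fin 2) (Fin 2) ℂ)) := by
  have hVm := SchrodingerBC.aestronglyMeasurable_of_piecewise hVpc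
  have hτ (j : Fin 2) := SchrodingerBC.traceRel_of_expr_eq (ha := ha) (hg j) (hsol j)
  have hfr := SchrodingerBC.isDeficiencyFrame_of_orthonormal horth hτ
  have hsurj := hfr.exists_traceRel (fun j => ⟨_, hτ j⟩)
    (fun j => ⟨_, SchrodingerBC.traceRel_star_eigen (hτ j)⟩)
  obtain ⟨hK, hK'⟩ := SchrodingerBC.deficiencySpaces_eq_span hVm hVbd hsurj horth hτ
  obtain ⟨b, hb⟩ := SchrodingerBC.exists_orthonormalBasis_of_eq_span horth hK
  obtain ⟨b', hb'⟩ := SchrodingerBC.exists_orthonormalBasis_of_eq_span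
    (SchrodingerBC.orthonormal_star horth hτ) hK'
  obtain ⟨Θ, hΘ⟩ := SchrodingerBC.exists_unitaryEquiv b b'
  have hΘ' (U : Matrix.unitaryGroup (Fin 2) ℂ) (j : Fin 2)
      (φ : SchrodingerBC.deficiencySpace (SchrodingerBC.minimalOp a ha V) Complex.I)
      (hφ : (φ : SchrodingerBC.L2I a) = (hg j).toL2) :
      (Θ U φ : SchrodingerBC.L2I a) =
        ∑ k, (U : Matrix (Fin 2) (Fin 2) ℂ) j k • star (hg k).toL2 := by
    have : φ = b j := Subtype.ext (hφ.trans (hb j).symm)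
    rw [this, hΘ]
    simp only [Submodule.coe_sum, Submodule.coe_smul, hb']
  have hext (U : Matrix.unitaryGroup (Fin 2) ℂ) :
      SchrodingerBC.vonNeumannExt (SchrodingerBC.minimalOp a ha V) (Θ U) =
        SchrodingerBC.bcOp a ha V (hfr.bcEquiv U : Matrix (Fin 2) (Fin 2) ℂ) := by
    rw [SchrodingerBC.bcOp, hfr.bcSubspace_bcEquiv]
    refine SchrodingerBC.vonNeumannExt_eq_schrodinger hVm hVbd hsurj hK (Θ U) fun j φ hφ => ?_
    have hm := (SchrodingerBC.traceRel a ha V).add_mem (hτ j)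
      ((SchrodingerBC.traceRel a ha V).sum_mem fun k (_ : k ∈ Finset.univ) =>
        (SchrodingerBC.traceRel a ha V).smul_mem ((U : Matrix (Fin 2) (Fin 2) ℂ) j k)
          (SchrodingerBC.traceRel_star_eigen (hτ k)))
    refine SchrodingerBC.exists_snd_mem_traceRel hm ?_ ?_
    · simp only [hΘ' U j φ hφ, Prod.fst_add, Prod.fst_sum, Prod.smul_fst]
    · simp only [Prod.snd_add, Prod.snd_sum, Prod.smul_snd]
  -- distinct unitary boundary conditions give distinct operators
  have hinj : Function.Injective fun U : Matrix.unitaryGroup (Fin 2) ℂ =>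
      SchrodingerBC.bcOp a ha V (U : Matrix (Fin 2) (Fin 2) ℂ) := by
    intro M N hMN
    have := SchrodingerBC.schrodinger_injective hsurj hMN
    rw [SchrodingerBC.bcSubspace_eq, SchrodingerBC.bcSubspace_eq] at this
    exact Subtype.ext (SchrodingerBC.isSplitting_plus_minus.eq_of_coordGraph_le this.le)
  refine ⟨hK, hK', fun U hU => ?_, Θ, hΘ', ?_, ?_, hfr.bcEquiv, fun U M => ?_, hext⟩
  · have h := hfr.linearIndependent_data hU
    simp only [← SchrodingerBC.traces_G ha hg] at h
    exact h
  · simp only [hext]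
    exact hinj.comp hfr.bcEquiv.injective
  · simp only [hext]
    ext S
    constructor
    · rintro ⟨U, rfl⟩
      refine ⟨SchrodingerBC.schrodinger_mono bot_le,
        SchrodingerBC.isSelfAdjoint_schrodinger hVm hVbd hsurj ?_⟩
      rw [SchrodingerBC.bcSubspace_eq]
      exact SchrodingerBC.isSplitting_plus_minus.isLagrangian_coordGraph (hfr.bcEquiv U).2
    · rintro ⟨hle, hS⟩
      obtain ⟨B, hB, rfl⟩ :=
        SchrodingerBC.exists_lagrangian_of_isSelfAdjoint hVm hVbd hsurj hle hS
      obtain ⟨M, hM, rfl⟩ := SchrodingerBC.isSplitting_plus_minus.exists_coordGraph_eq hB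
      obtain ⟨U, hU⟩ := hfr.bcEquiv.surjective ⟨M, hM⟩
      refine ⟨U, ?_⟩
      simp only [hU, SchrodingerBC.bcOp, SchrodingerBC.bcSubspace_eq]
  · rw [← hfr.mem_bcSubspace_iff]
    simp only [← SchrodingerBC.traces_G ha hg]
    rfl
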